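/- \textbf{Setup.} Let $(D,\mathfrak m,\Bbbk)$ be a Noetherian local domain of Krull dimension $d$ and prime characteristic $p>0$, with fraction field $\mathbb F$. Fix a vector $\mathbf a\in\mathbb R^d$ such that $\mathbb Z^d\to\mathbb R$, $\mathbf u\mapsto\langle\mathbf a,\mathbf u\rangle$, is injective, and order $\mathbb Z^d$ through this embedding. Let $\nu:\mathbb F^\times\to\mathbb Z^d$ be a valuation with value group $\mathbb Z^d$, i.e. a surjective group homomorphism with $\nu(x+y)\ge\min(\nu(x),\nu(y))$ whenever $x+y\neq0$. Put $\nu(M)=\nu(M\setminus\{0\})$ for $M\subseteq\mathbb F$ and $\mathbb F_{\ge\mathbf u}=\{0\}\cup\{x:\nu(x)\ge\mathbf u\}$; let $V=\mathbb F_{\ge\mathbf 0}$ be the valuation ring and $\Bbbk_V$ its residue field. Let $S=\nu(D)$ and let $C=\operatorname{cone}(S)\subseteq\mathbb R^d$ be the closure of the set $C_0$ of all finite nonnegative real combinations of elements of $S$. Assume that $\nu$ is \emph{OK relative to $D$}: $D$ is a local subring of $V$; $\langle\mathbf a,\mathbf u\rangle>0$ for every nonzero $\mathbf u\in C$; the residue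 field extension $\Bbbk\hookrightarrow\Bbbk_V$ is finite; and there is $\mathbf v\in\mathbb Z^d$ with $D\cap\mathbb F_{\ge n\mathbf v}\subseteq\mathfrak m^n$ for all integers $n\ge0$. Let $q$ run over the powers $p^e$, $e\ge0$. A \emph{$p$-family} is a sequence $I_\bullet=\{I_q\}$ of ideals of $D$ with $I_q^{[p]}\subseteq I_{pq}$ for all $q$, where $I^{[p]}$ is the ideal generated by the $p$-th powers of the elements of $I$. The associated \emph{$p$-body} is $\Delta(I_\bullet)=\bigcup_q\bigl(\tfrac1q\,\nu(I_q)+C\bigr)\subseteq C$. A \emph{truncation} of $C$ is a set $C\cap\{\mathbf u:\langle\mathbf b,\mathbf u\rangle<\alpha\}$ with $\alpha>0$ and $\langle\mathbf b,\mathbf u\rangle>0$ for all nonzero $\mathbf u\in C$. \textbf{Theorem.} (1) Let $I_\bullet$ and $J_\bullet$ be $p$-families of ideals of $D$ with $I_q\subseteq J_q$ for all $q$, and suppose that there is a positive integer $c$ with $\mathfrak m^{cq}\cap I_q=\mathfrak m^{cq}\cap J_q$ for all $q$. Then $$\lim_{q\to\infty}\frac{\ell_D(J_q/I_q)}{q^d}=[\Bbbk_V:\Bbbk]\cdot\operatorname{vol}_{\mathbb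 R^d}\bigl(\Delta(J_\bullet)\setminus\Delta(I_\bullet)\bigr)<\infty .$$ Moreover, there is a truncation of $C$ outside of which $\Delta(I_\bullet)$ and $\Delta(J_\bullet)$ agree up to boundary points: outside of it their interiors agree, their closures agree, and their symmetric difference has Lebesgue measure zero; if $C_0$ is closed (for instance, if $S$ is finitely generated), then $\Delta(I_\bullet)$ and $\Delta(J_\bullet)$ themselves agree outside of it. (2) If $I_\bullet$ is a $p$-family of $\mathfrak m$-primary ideals of $D$, then the limit $\operatorname{vol}_D(I_\bullet)=\lim_{q\to\infty}\ell_D(D/I_q)/q^d$ exists, and $$\operatorname{vol}_D(I_\bullet)=[\Bbbk_V:\Bbbk]\cdot\operatorname{vol}_{\mathbb R^d}\bigl(C\setminus\Delta(I_\bullet)\bigr)<\infty .$$ -/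

import Mathlib

open scoped ENNReal Topology Pointwise

namespace PBody

/-! ### Lattice points and cones

Real `d`-space is `Fin d → ℝ` with its product topology and Lebesgue measure; the standard inner
product is `⬝ᵥ`. Only the topology, the measure and the inner product are used. -/

/-- A lattice point, viewed in real space. -/
def toReal {d : ℕ} (u : Fin d → ℤ) : Fin d → ℝ := fun i => (u i : ℝ)

/-- The additive map `ℤ^d → ℝ`, `u ↦ ⟨a, u⟩`, induced by a vector `a`. When it is injective, the
order that `ℤ^d` inherits from `ℝ` is `u ≤ v ↔ weight a u ≤ weight a v`. -/
def weight {d : ℕ} (a : Fin d → ℝ) (u : Fin d → ℤ) : ℝ := a ⬝ᵥ toReal u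

lemma weight_zero {d : ℕ} (a : Fin d → ℝ) : weight a 0 = 0 := by
  simp [weight, toReal, dotProduct]

lemma weight_add {d : ℕ} (a : Fin d → ℝ) (u v : Fin d → ℤ) :
    weight a (u + v) = weight a u + weight a v := by
  simp [weight, toReal, dotProduct, mul_add, Finset.sum_add_distrib]

/-- All conical combinations (finite, with nonnegative real coefficients) of points of a set of
lattice points; this is the convex cone that it generates, without taking the closure. -/
def conicalHull {d : ℕ} (S : Set (Fin d → ℤ)) : Set (Fin d → ℝ) :=
  (PointedCone.hull ℝ (toReal '' S) : Set (Fin d → ℝ))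

/-- The closed cone generated by a set of lattice points. -/
def closedCone {d : ℕ} (S : Set (Fin d → ℤ)) : Set (Fin d → ℝ) := closure (conicalHull S)

/-- `T` is a truncation of the cone `C`: the intersection of `C` with a halfspace
`{u | ⟨b, u⟩ < α}`, where `α > 0` and `b` is positive on the nonzero points of `C`. -/
def IsTruncation {d : ℕ} (C T : Set (Fin d → ℝ)) : Prop :=
  ∃ (b : Fin d → ℝ) (α : ℝ), (∀ u ∈ C, u ≠ 0 → 0 < b ⬝ᵥ u) ∧ 0 < α ∧
    T = C ∩ {u | b ⬝ᵥ u < α}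

/-- The `p`-body `Δ(S, T) = ⋃_q ((1/q) T_q + cone(S))`, where `q = p ^ e` runs over the powers of
`p` and the term `T_q` is written `T e`. -/
def pBody {d : ℕ} (p : ℕ) (S : Set (Fin d → ℤ)) (T : ℕ → Set (Fin d → ℤ)) :
    Set (Fin d → ℝ) :=
  ⋃ e : ℕ, (((p : ℝ) ^ e)⁻¹ • (toReal '' T e) + closedCone S)

/-! ### Valuations with value group `ℤ^d` -/

/-- A valuation on the field `F` with value group `ℤ^d`, ordered through the map `weight a`: a
surjective group homomorphism `ν : Fˣ → ℤ^d` with `ν (x + y) ≥ min (ν x) (ν y)` whenever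
`x + y ≠ 0`. -/
structure LatticeValuation (F : Type*) [Field F] {d : ℕ} (a : Fin d → ℝ) where
  /-- the underlying function -/
  val : Fˣ → (Fin d → ℤ)
  val_mul : ∀ x y : Fˣ, val (x * y) = val x + val y
  surjective : Function.Surjective val
  val_add : ∀ x y z : Fˣ, (z : F) = x + y →
    min (weight a (val x)) (weight a (val y)) ≤ weight a (val z)

namespace LatticeValuation

variable {F : Type*} [Field F] {d : ℕ} {a : Fin d → ℝ} (ν : LatticeValuation F a)

/-- The image `ν(M) = ν(M ∖ {0})` of a subset `M` of `F`. -/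
def image (M : Set F) : Set (Fin d → ℤ) := {u | ∃ x : Fˣ, (x : F) ∈ M ∧ ν.val x = u}

/-- The set `F_{≥ u}` of all `x` in `F` with `x = 0` or `ν x ≥ u`. -/
def geSet (u : Fin d → ℤ) : Set F :=
  {x | ∀ y : Fˣ, (y : F) = x → weight a u ≤ weight a (ν.val y)}

lemma val_one : ν.val 1 = 0 := by
  have h := ν.val_mul 1 1
  rw [mul_one] at h
  exact left_eq_add.mp h

lemma val_inv (x : Fˣ) : ν.val x⁻¹ = -ν.val x := by
  have h := ν.val_mul x x⁻¹
  rw [mul_inv_cancel, val_one] at h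
  exact (neg_eq_of_add_eq_zero_right h.symm).symm

lemma val_neg_one : ν.val (-1) = 0 := by
  have h := ν.val_mul (-1) (-1)
  rw [neg_mul_neg, mul_one, val_one] at h
  funext i
  have hi := congrFun h i
  simp only [Pi.zero_apply, Pi.add_apply] at hi ⊢
  omega

/-- The valuation ring `V = F_{≥ 0}` of `ν`. -/
def ring : ValuationSubring F where
  carrier := ν.geSet 0
  mul_mem' := by
    intro x y hx hy z hz
    have hx0 : x ≠ 0 := by rintro rfl; exact z.ne_zero (by rw [hz]; simp)
    have hy0 : y ≠ 0 := by rintro rfl; exact z.ne_zero (by rw [hz]; simp)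
    have hxy : z = Units.mk0 x hx0 * Units.mk0 y hy0 := by ext; simpa using hz
    have h1 := hx (Units.mk0 x hx0) rfl
    have h2 := hy (Units.mk0 y hy0) rfl
    rw [hxy, ν.val_mul, weight_add]
    rw [weight_zero] at *
    exact add_nonneg h1 h2
  one_mem' := by
    intro y hy
    have : y = 1 := by ext; simpa using hy
    rw [this, val_one]
  add_mem' := by
    intro x y hx hy z hz
    by_cases hx0 : x = 0
    · exact hy z (by simpa [hx0] using hz)
    by_cases hy0 : y = 0
    · exact hx z (by simpa [hy0] using hz)
    exact (le_min (hx (Units.mk0 x hx0) rfl) (hy (Units.mk0 y hy0) rfl)).trans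
      (ν.val_add _ _ z (by simpa using hz))
  zero_mem' := fun y hy => absurd hy y.ne_zero
  neg_mem' := by
    intro x hx z hz
    have h := hx (-1 * z) (by simp [hz])
    rwa [ν.val_mul, val_neg_one, zero_add] at h
  mem_or_inv_mem' := by
    intro x
    by_cases hx0 : x = 0
    · left
      intro y hy
      exact absurd (hy.trans hx0) y.ne_zero
    have hs : weight a (ν.val (Units.mk0 x hx0)) + weight a (ν.val (Units.mk0 x hx0)⁻¹) = 0 := by
      rw [← weight_add, ν.val_inv, add_neg_cancel, weight_zero]
    rcases le_total 0 (weight a (ν.val (Units.mk0 x hx0))) with h | h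
    · left
      intro y hy
      have : y = Units.mk0 x hx0 := by ext; simpa using hy
      rw [this, weight_zero]
      exact h
    · right
      intro y hy
      have : y = (Units.mk0 x hx0)⁻¹ := by ext; simpa using hy
      rw [this, weight_zero]
      linarith

variable (D : Type*) [CommRing D] [IsLocalRing D] [Algebra D F]

/-- `ν` dominates the local ring `D`: the ring `D` maps into the valuation ring of `ν`, by a local
homomorphism. -/
structure Dominates : Prop where
  mem_ring : ∀ x : D, algebraMap D F x ∈ ν.ring
  isLocalHom : IsLocalHom ((algebraMap D F).codRestrict ν.ring mem_ring)

/-- The image `ν(I)` of an ideal `I` of `D`. -/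
def idealImage {D : Type*} [CommRing D] [Algebra D F] (I : Ideal D) : Set (Fin d → ℤ) :=
  ν.image (algebraMap D F '' (I : Set D))

/-- The semigroup `S = ν(D)`. -/
def semigroup (D : Type*) [CommRing D] [Algebra D F] : Set (Fin d → ℤ) :=
  ν.image (Set.range (algebraMap D F))

/-- The extension of residue fields `k → k_V` resulting from the domination of `D` by `ν`. -/
noncomputable def residueMap {D : Type*} [CommRing D] [IsLocalRing D] [Algebra D F]
    (h : ν.Dominates D) :
    IsLocalRing.ResidueField D →+* IsLocalRing.ResidueField ν.ring :=
  haveI := h.isLocalHom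
  IsLocalRing.ResidueField.map ((algebraMap D F).codRestrict ν.ring h.mem_ring)

/-- The degree `[k_V : k]` of the extension of residue fields. -/
noncomputable def residueDegree {D : Type*} [CommRing D] [IsLocalRing D] [Algebra D F]
    (h : ν.Dominates D) : ℕ :=
  letI := (ν.residueMap h).toAlgebra
  Module.finrank (IsLocalRing.ResidueField D) (IsLocalRing.ResidueField ν.ring)

/-- `ν` is OK relative to the local domain `D`: it strongly dominates `D` (that is, it dominates
`D`, and `⟨a, u⟩ > 0` for all nonzero `u` in the closed cone generated by `ν(D)`), the extension of
residue fields is finite, and for some `v` in `ℤ^d` one has `D ∩ F_{≥ n v} ⊆ 𝔪 ^ n` for all `n`. -/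
structure IsOK : Prop where
  dominates : ν.Dominates D
  pos_of_mem_cone : ∀ u ∈ closedCone (ν.semigroup D), u ≠ 0 → 0 < a ⬝ᵥ u
  residue_finite : (ν.residueMap dominates).Finite
  exists_vector : ∃ v : Fin d → ℤ, ∀ (n : ℕ) (x : D),
    algebraMap D F x ∈ ν.geSet (n • v) → x ∈ IsLocalRing.maximalIdeal D ^ n

/-- The `p`-body `Δ(S, ν(I))` of a family `I` of ideals of `D`, where `S = ν(D)`. -/
def familyBody {D : Type*} [CommRing D] [Algebra D F] (p : ℕ) (I : ℕ → Ideal D) :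
    Set (Fin d → ℝ) :=
  pBody p (ν.semigroup D) (fun e => ν.idealImage (I e))

end LatticeValuation

/-! ### `p`-families of ideals -/

/-- A `p`-family of ideals in a ring of characteristic `p`: a sequence `I_q` indexed by the powers
`q = p ^ e` of `p`, written `I e`, with `I_q^{[p]} ⊆ I_{pq}`; here `I^{[p]}` is the ideal generated
by the `p`-th powers of the elements of `I`. -/
def IsPFamily {R : Type*} [CommRing R] (p : ℕ) (I : ℕ → Ideal R) : Prop :=
  ∀ e : ℕ, Ideal.span ((fun x : R => x ^ p) '' (I e : Set R)) ≤ I (e + 1)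

/-- An ideal of a local ring that is primary to the maximal ideal. -/
def IsMPrimary {R : Type*} [CommRing R] [IsLocalRing R] (I : Ideal R) : Prop :=
  I.IsPrimary ∧ I.radical = IsLocalRing.maximalIdeal R

end PBody

namespace PBody

/-! ### Semigroups of lattice points and their cones -/

section Cone

variable {d : ℕ}

/-! Lengths are turned into counts of lattice points. Filter an ideal `I` by weight. Division by an
element of value `u` embeds the graded piece at `u` into the residue field of the valuation ring, so
its length is at most the residue degree `r`, and it vanishes unless `u ∈ ν(I)` (`gradedLength_le`,
`gradedLength_eq_zero`). Conversely, finitely many residues generating this field as a `D`-module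
have a common denominator `c`, and the piece has full length `r` once `u - ν(c) ∈ ν(I)`
(`gradedLength_eq`). Summing below a weight `t` squeezes the length of `I / (I ∩ F_{≥t})` between
two multiples of `r`, with a shift `ν(c)` independent of `I` and `t`
(`IsOK.relLength_geIdeal_bounds`).

For `I = I_q` and `t = qα`, both counts are asymptotic to `q^d` times the volume of the `p`-body cut
by `⟨a, y⟩ < α` (`IsPSystem.tendsto_ncard`). The upper bound holds because `ν(I_q)/q` lies in the
body. For the lower one, around an interior point `y` all lattice points within distance `qδ` of
`qy` eventually lie in `ν(I_q)`, even after a fixed shift (`IsPSystem.eventually_mem`). The cut body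
is bounded, since `a` is positive on the cone, and has null boundary, since an interior direction of
the cone moves the boundary of the body into its interior.

If `I_q` and `J_q` agree in `𝔪^{cq}`, the last OK condition makes them agree in weights at least
`qα` for a fixed `α`. Thus the length of `J_q / I_q` is a difference of two truncated lengths, and
the bodies agree, up to boundary, where `⟨a, y⟩ > α` (`IsPSystem.mem_pBody_of_mem_interior`,
`IsPSystem.volume_diff`). The second assertion is the case where `J_q` is the unit ideal, because an
`𝔪`-primary `p`-family contains `𝔪^{cq}` for some `c` (`IsPFamily.exists_maximalIdeal_pow_le`). -/

@[simp] lemma toReal_zero : toReal (0 : Fin d → ℤ) = 0 := by ext; simp [toReal]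

@[simp] lemma toReal_add (u v : Fin d → ℤ) : toReal (u + v) = toReal u + toReal v := by
  ext; simp [toReal]

@[simp] lemma toReal_sub (u v : Fin d → ℤ) : toReal (u - v) = toReal u - toReal v := by
  ext; simp [toReal]

@[simp] lemma toReal_nsmul (n : ℕ) (u : Fin d → ℤ) : toReal (n • u) = (n : ℝ) • toReal u := by
  ext; simp [toReal]

@[simp] lemma toReal_apply (u : Fin d → ℤ) (i : Fin d) : toReal u i = (u i : ℝ) := rfl

lemma toReal_injective : Function.Injective (toReal : (Fin d → ℤ) → Fin d → ℝ) := by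
  intro u v h
  ext i
  simpa using congrFun h i

lemma zero_mem_conicalHull (S : Set (Fin d → ℤ)) : (0 : Fin d → ℝ) ∈ conicalHull S :=
  (PointedCone.hull ℝ (toReal '' S)).zero_mem

lemma add_mem_conicalHull {S : Set (Fin d → ℤ)} {x y : Fin d → ℝ} (hx : x ∈ conicalHull S)
    (hy : y ∈ conicalHull S) : x + y ∈ conicalHull S :=
  (PointedCone.hull ℝ (toReal '' S)).add_mem hx hy

lemma smul_mem_conicalHull {S : Set (Fin d → ℤ)} {x : Fin d → ℝ} (hx : x ∈ conicalHull S)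
    {c : ℝ} (hc : 0 ≤ c) : c • x ∈ conicalHull S :=
  (PointedCone.hull ℝ (toReal '' S)).smul_mem hc hx

lemma toReal_mem_conicalHull {S : Set (Fin d → ℤ)} {s : Fin d → ℤ} (hs : s ∈ S) :
    toReal s ∈ conicalHull S :=
  PointedCone.subset_hull ⟨s, hs, rfl⟩

lemma convex_conicalHull (S : Set (Fin d → ℤ)) : Convex ℝ (conicalHull S) :=
  (PointedCone.hull ℝ (toReal '' S)).convex

lemma isClosed_closedCone (S : Set (Fin d → ℤ)) : IsClosed (closedCone S) := isClosed_closure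

lemma zero_mem_closedCone (S : Set (Fin d → ℤ)) : (0 : Fin d → ℝ) ∈ closedCone S :=
  subset_closure (zero_mem_conicalHull S)

lemma toReal_mem_closedCone {S : Set (Fin d → ℤ)} {s : Fin d → ℤ} (hs : s ∈ S) :
    toReal s ∈ closedCone S := subset_closure (toReal_mem_conicalHull hs)

lemma add_mem_closedCone {S : Set (Fin d → ℤ)} {x y : Fin d → ℝ} (hx : x ∈ closedCone S)
    (hy : y ∈ closedCone S) : x + y ∈ closedCone S :=
  map_mem_closure₂ continuous_add hx hy fun _ ha _ hb => add_mem_conicalHull ha hb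

lemma smul_mem_closedCone {S : Set (Fin d → ℤ)} {x : Fin d → ℝ} (hx : x ∈ closedCone S)
    {c : ℝ} (hc : 0 ≤ c) : c • x ∈ closedCone S :=
  map_mem_closure (continuous_const_smul c) hx fun _ ha => smul_mem_conicalHull ha hc

lemma add_mem_interior_closedCone {S : Set (Fin d → ℤ)} {x y : Fin d → ℝ}
    (hx : x ∈ closedCone S) (hy : y ∈ interior (closedCone S)) :
    x + y ∈ interior (closedCone S) := by
  have h : {x} + interior (closedCone S) ⊆ interior (closedCone S) := by
    refine interior_maximal ?_ isOpen_interior.add_left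
    rintro _ ⟨_, rfl, z, hz, rfl⟩
    exact add_mem_closedCone hx (interior_subset hz)
  exact h ⟨x, rfl, y, hy, rfl⟩

lemma smul_mem_interior_closedCone {S : Set (Fin d → ℤ)} {x : Fin d → ℝ}
    (hx : x ∈ interior (closedCone S)) {c : ℝ} (hc : 0 < c) :
    c • x ∈ interior (closedCone S) := by
  have h : c • interior (closedCone S) ⊆ interior (closedCone S) := by
    refine interior_maximal ?_ (isOpen_interior.smul₀ hc.ne')
    rintro _ ⟨z, hz, rfl⟩
    exact smul_mem_closedCone (interior_subset hz) hc.le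
  exact h ⟨x, hx, rfl⟩

/-- A semigroup of lattice points that generates the lattice contains, for some point `σ` and all
`M`, the lattice points of the box of radius `M` around `M • σ`; the cone contains the full box. -/
lemma exists_center {S : AddSubmonoid (Fin d → ℤ)}
    (hS : ∀ z, ∃ s ∈ S, ∃ s' ∈ S, s - s' = z) :
    ∃ σ ∈ S, (∀ (M : ℕ) (z : Fin d → ℤ), (∀ i, |z i| ≤ M) → M • σ + z ∈ S) ∧
      ∀ (t : ℝ) (w : Fin d → ℝ), (∀ i, |w i| ≤ t) →
        t • toReal σ + w ∈ conicalHull (S : Set (Fin d → ℤ)) := by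
  -- With `s i - s' i` the `i`-th unit vector and `σ` the sum of all `s i + s' i`, the point `M • σ
  -- + z` has coefficients `M + z i` on `s i` and `M - z i` on `s' i`, all nonnegative on the box.
  choose s hs s' hs' hss using fun i : Fin d => hS (Pi.single i 1)
  refine ⟨∑ i, (s i + s' i), sum_mem fun i _ => add_mem (hs i) (hs' i), fun M z hz => ?_,
    fun t w hw => ?_⟩
  · have h : M • ∑ i, (s i + s' i) + z =
        ∑ i, ((M + z i).toNat • s i + (M - z i).toNat • s' i) := by
      have hz' : z = ∑ i, z i • (s i - s' i) := by
        conv_lhs => rw [← Finset.univ_sum_single z]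
        refine Finset.sum_congr rfl fun i _ => ?_
        rw [hss i]
        ext j
        by_cases hj : j = i
        · subst hj; simp
        · simp [hj]
      conv_lhs => rw [hz']
      rw [Finset.smul_sum, ← Finset.sum_add_distrib]
      refine Finset.sum_congr rfl fun i _ => ?_
      have h1 := abs_le.mp (hz i)
      rw [← natCast_zsmul (s i), ← natCast_zsmul (s' i), Int.toNat_of_nonneg (by linarith),
        Int.toNat_of_nonneg (by linarith), ← natCast_zsmul]
      module
    rw [h]
    exact sum_mem fun i _ => add_mem (nsmul_mem (hs i) _) (nsmul_mem (hs' i) _)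
  · have hsum : toReal (∑ i, (s i + s' i)) = ∑ i, (toReal (s i) + toReal (s' i)) := by
      ext j; simp
    have hw' : w = ∑ i, w i • (toReal (s i) - toReal (s' i)) := by
      conv_lhs => rw [← Finset.univ_sum_single w]
      refine Finset.sum_congr rfl fun i _ => ?_
      rw [← toReal_sub, hss i]
      ext j
      by_cases hj : j = i
      · subst hj; simp
      · simp [hj]
    have h : t • toReal (∑ i, (s i + s' i)) + w =
        ∑ i, ((t + w i) • toReal (s i) + (t - w i) • toReal (s' i)) := by
      conv_lhs => rw [hw']
      rw [hsum, Finset.smul_sum, ← Finset.sum_add_distrib]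
      refine Finset.sum_congr rfl fun i _ => ?_
      module
    rw [h]
    refine (PointedCone.hull ℝ (toReal '' (S : Set (Fin d → ℤ)))).sum_mem fun i _ => ?_
    have h1 := abs_le.mp (hw i)
    exact add_mem_conicalHull
      (smul_mem_conicalHull (toReal_mem_conicalHull (hs i)) (by linarith))
      (smul_mem_conicalHull (toReal_mem_conicalHull (hs' i)) (by linarith))

lemma mem_interior_conicalHull {S : Set (Fin d → ℤ)} {x : Fin d → ℝ}
    (h : ∀ w : Fin d → ℝ, (∀ i, |w i| ≤ 1) → x + w ∈ conicalHull S) :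
    x ∈ interior (conicalHull S) := by
  refine mem_interior.mpr ⟨Metric.ball x 1, fun y hy => ?_, Metric.isOpen_ball,
    Metric.mem_ball_self one_pos⟩
  have := h (y - x) fun i => by
    rw [Metric.mem_ball, dist_eq_norm] at hy
    exact (norm_le_pi_norm (y - x) i).trans hy.le
  simpa using this

/-- A convex set with nonempty interior has the same interior as its closure. -/
lemma interior_closedCone {S : AddSubmonoid (Fin d → ℤ)}
    (hS : ∀ z, ∃ s ∈ S, ∃ s' ∈ S, s - s' = z) :
    interior (closedCone (S : Set (Fin d → ℤ))) = interior (conicalHull S) := by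
  obtain ⟨σ, -, -, h⟩ := exists_center hS
  refine (convex_conicalHull _).interior_closure_eq_interior_of_nonempty_interior
    ⟨toReal σ, mem_interior_conicalHull fun w hw => ?_⟩
  simpa using h 1 w hw

/-- Round down the coefficients of a conical combination: the fractional parts leave a remainder in
the cone, bounded independently of `t`. -/
lemma exists_approx_of_mem_conicalHull {S : AddSubmonoid (Fin d → ℤ)} {x : Fin d → ℝ}
    (hx : x ∈ conicalHull (S : Set (Fin d → ℤ))) :
    ∃ B : ℝ, ∀ t : ℝ, 0 ≤ t → ∃ s ∈ S, ‖t • x - toReal s‖ ≤ B ∧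
      t • x - toReal s ∈ conicalHull (S : Set (Fin d → ℤ)) := by
  refine Submodule.span_induction (p := fun x _ => ∃ B : ℝ, ∀ t : ℝ, 0 ≤ t → ∃ s ∈ S,
    ‖t • x - toReal s‖ ≤ B ∧ t • x - toReal s ∈ conicalHull (S : Set (Fin d → ℤ)))
    ?_ ?_ ?_ ?_ hx
  · rintro _ ⟨s, hs, rfl⟩
    refine ⟨‖toReal s‖, fun t ht => ⟨⌊t⌋₊ • s, nsmul_mem hs _, ?_⟩⟩
    have h1 := Nat.floor_le ht
    have h2 := (Nat.lt_floor_add_one t).le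
    rw [toReal_nsmul, ← sub_smul]
    refine ⟨?_, smul_mem_conicalHull (toReal_mem_conicalHull hs) (by linarith)⟩
    rw [norm_smul]
    refine mul_le_of_le_one_left (norm_nonneg _) ?_
    rw [Real.norm_eq_abs, abs_le]
    constructor <;> linarith
  · exact ⟨0, fun t _ => ⟨0, zero_mem _, by simp, by simpa using zero_mem_conicalHull _⟩⟩
  · rintro x y - - ⟨B, hB⟩ ⟨B', hB'⟩
    refine ⟨B + B', fun t ht => ?_⟩
    obtain ⟨s, hs, h1, h2⟩ := hB t ht
    obtain ⟨s', hs', h1', h2'⟩ := hB' t ht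
    refine ⟨s + s', add_mem hs hs', ?_⟩
    have : t • (x + y) - toReal (s + s') = (t • x - toReal s) + (t • y - toReal s') := by
      rw [toReal_add]; module
    rw [this]
    exact ⟨(norm_add_le _ _).trans (add_le_add h1 h1'), add_mem_conicalHull h2 h2'⟩
  · rintro c x - ⟨B, hB⟩
    refine ⟨B, fun t ht => ?_⟩
    obtain ⟨s, hs, h⟩ := hB (t * c) (mul_nonneg ht c.2)
    refine ⟨s, hs, ?_⟩
    have : t • c • x = (t * (c : ℝ)) • x := by
      rw [mul_smul]; rfl
    rwa [this]

/-- Near the ray of an interior point of the cone, the semigroup contains all lattice points that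
are far away from the origin. -/
lemma eventually_mem_of_mem_interior {S : AddSubmonoid (Fin d → ℤ)}
    (hS : ∀ z, ∃ s ∈ S, ∃ s' ∈ S, s - s' = z) {x : Fin d → ℝ}
    (hx : x ∈ interior (closedCone (S : Set (Fin d → ℤ)))) :
    ∃ δ > 0, ∀ᶠ n : ℕ in Filter.atTop, ∀ u : Fin d → ℤ,
      ‖toReal u - (n : ℝ) • x‖ ≤ n * δ → u ∈ S := by
  obtain ⟨σ, hσ, hσS, -⟩ := exists_center hS
  rw [interior_closedCone hS] at hx
  have hlim : Filter.Tendsto (fun ε : ℝ => x - ε • toReal σ) (𝓝[>] 0) (𝓝 x) := by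
    have : Filter.Tendsto (fun ε : ℝ => x - ε • toReal σ) (𝓝 0) (𝓝 (x - (0 : ℝ) • toReal σ)) :=
      Continuous.tendsto (by fun_prop) 0
    simp only [zero_smul, sub_zero] at this
    exact this.mono_left nhdsWithin_le_nhds
  -- Approximate the multiples of the retracted point `x - ε • σ` by elements of `S`; the reserve `n
  -- * ε` of copies of `σ` then absorbs all errors.
  obtain ⟨ε, hε, hε0⟩ := ((hlim.eventually (isOpen_interior.mem_nhds hx)).and
    self_mem_nhdsWithin).exists
  replace hε0 : 0 < ε := hε0
  obtain ⟨B, hB⟩ := exists_approx_of_mem_conicalHull (interior_subset hε)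
  refine ⟨ε / 2, by positivity, ?_⟩
  -- The error is at most `n * (ε / 2) + B + ‖σ‖`; this bound keeps it below `⌊n * ε⌋₊`, where the 1
  -- pays for the floor.
  have hev : ∀ᶠ n : ℕ in Filter.atTop, B + ‖toReal σ‖ + 1 ≤ (n : ℝ) * (ε / 2) :=
    (tendsto_natCast_atTop_atTop.atTop_mul_const (by positivity)).eventually_ge_atTop _
  filter_upwards [hev] with n hn u hu
  obtain ⟨s, hs, hsB, -⟩ := hB n n.cast_nonneg
  have hf1 := Nat.floor_le (show 0 ≤ n * ε by positivity)
  have hf2 := Nat.lt_floor_add_one (n * ε)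
  set m := ⌊n * ε⌋₊
  have key : m • σ + (u - s - m • σ) ∈ S := by
    refine hσS m _ fun i => ?_
    have h1 : ‖toReal (u - s - m • σ)‖ ≤ n * (ε / 2) + B + ‖toReal σ‖ := by
      have : toReal (u - s - m • σ) = (toReal u - (n : ℝ) • x) +
          ((n : ℝ) • (x - ε • toReal σ) - toReal s) + (n * ε - m) • toReal σ := by
        rw [toReal_sub, toReal_sub, toReal_nsmul]; module
      rw [this]
      refine (norm_add_le _ _).trans (add_le_add ((norm_add_le _ _).trans
        (add_le_add hu hsB)) ?_)
      rw [norm_smul]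
      refine mul_le_of_le_one_left (norm_nonneg _) ?_
      rw [Real.norm_eq_abs, abs_le]
      constructor <;> linarith
    have h2 := norm_le_pi_norm (toReal (u - s - m • σ)) i
    have h3 : ((|(u - s - m • σ) i| : ℤ) : ℝ) ≤ (m : ℤ) := by
      rw [toReal_apply, Real.norm_eq_abs] at h2
      push_cast at h2 ⊢
      linarith
    exact_mod_cast h3
  have := add_mem hs key
  rwa [show s + (m • σ + (u - s - m • σ)) = u by abel] at this

end Cone

end PBody

namespace PBody

/-! ### `p`-systems and their `p`-bodies -/

/-- A `p`-system in a semigroup `S`: a sequence `T` of subsets of `S`, indexed by the exponents of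
the powers of `p`, with `T e + S ⊆ T e` and `p • T e ⊆ T (e + 1)`. -/
structure IsPSystem {d : ℕ} (p : ℕ) (S : AddSubmonoid (Fin d → ℤ))
    (T : ℕ → Set (Fin d → ℤ)) : Prop where
  subset : ∀ e, T e ⊆ S
  add_mem : ∀ e, ∀ u ∈ T e, ∀ s ∈ S, u + s ∈ T e
  nsmul_mem : ∀ e, ∀ u ∈ T e, p • u ∈ T (e + 1)

section Body

variable {d p : ℕ} {S : AddSubmonoid (Fin d → ℤ)} {T : ℕ → Set (Fin d → ℤ)}

lemma mem_pBody {S : Set (Fin d → ℤ)} {y : Fin d → ℝ} :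
    y ∈ pBody p S T ↔ ∃ e, ∃ u ∈ T e, ∃ z ∈ closedCone S, ((p : ℝ) ^ e)⁻¹ • toReal u + z = y := by
  simp only [pBody, Set.mem_iUnion, Set.mem_add, Set.mem_smul_set, Set.mem_image]
  constructor
  · rintro ⟨e, _, ⟨_, ⟨u, hu, rfl⟩, rfl⟩, z, hz, rfl⟩
    exact ⟨e, u, hu, z, hz, rfl⟩
  · rintro ⟨e, u, hu, z, hz, rfl⟩
    exact ⟨e, _, ⟨_, ⟨u, hu, rfl⟩, rfl⟩, z, hz, rfl⟩

lemma pBody_mono {S : Set (Fin d → ℤ)} {T' : ℕ → Set (Fin d → ℤ)} (h : ∀ e, T e ⊆ T' e) :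
    pBody p S T ⊆ pBody p S T' := by
  intro y hy
  obtain ⟨e, u, hu, z, hz, rfl⟩ := mem_pBody.mp hy
  exact mem_pBody.mpr ⟨e, u, h e hu, z, hz, rfl⟩

lemma add_mem_pBody {S : Set (Fin d → ℤ)} {y z : Fin d → ℝ} (hy : y ∈ pBody p S T)
    (hz : z ∈ closedCone S) : y + z ∈ pBody p S T := by
  obtain ⟨e, u, hu, z', hz', rfl⟩ := mem_pBody.mp hy
  exact mem_pBody.mpr ⟨e, u, hu, z' + z, add_mem_closedCone hz' hz, by abel⟩

lemma inv_pow_smul_mem_pBody {S : Set (Fin d → ℤ)} {e : ℕ} {u : Fin d → ℤ} (hu : u ∈ T e) :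
    ((p : ℝ) ^ e)⁻¹ • toReal u ∈ pBody p S T :=
  mem_pBody.mpr ⟨e, u, hu, 0, zero_mem_closedCone S, add_zero _⟩

lemma IsPSystem.pow_nsmul_mem (hT : IsPSystem p S T) {e : ℕ} {u : Fin d → ℤ} (hu : u ∈ T e)
    (k : ℕ) : p ^ k • u ∈ T (e + k) := by
  induction k with
  | zero => simpa using hu
  | succ k ih =>
    rw [pow_succ', mul_smul, ← add_assoc]
    exact hT.nsmul_mem _ _ ih

lemma IsPSystem.pBody_subset (hT : IsPSystem p S T) :
    pBody p (S : Set (Fin d → ℤ)) T ⊆ closedCone S := by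
  intro y hy
  obtain ⟨e, u, hu, z, hz, rfl⟩ := mem_pBody.mp hy
  exact add_mem_closedCone
    (smul_mem_closedCone (toReal_mem_closedCone (hT.subset e hu)) (by positivity)) hz

/-- The body is a countable union of translates of a closed cone. -/
lemma measurableSet_pBody (S : Set (Fin d → ℤ)) : MeasurableSet (pBody p S T) := by
  refine MeasurableSet.iUnion fun e => ?_
  have : ((p : ℝ) ^ e)⁻¹ • (toReal '' T e) + closedCone S =
      ⋃ u ∈ T e, (fun z => ((p : ℝ) ^ e)⁻¹ • toReal u + z) '' closedCone S := by
    ext y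
    simp only [Set.mem_iUnion, Set.mem_add, Set.mem_smul_set, Set.mem_image]
    constructor
    · rintro ⟨_, ⟨_, ⟨u, hu, rfl⟩, rfl⟩, z, hz, rfl⟩
      exact ⟨u, hu, z, hz, rfl⟩
    · rintro ⟨u, hu, z, hz, rfl⟩
      exact ⟨_, ⟨_, ⟨u, hu, rfl⟩, rfl⟩, z, hz, rfl⟩
  rw [this]
  refine MeasurableSet.biUnion (Set.to_countable _) fun u _ => ?_
  exact ((Homeomorph.addLeft _).isClosedMap _ (isClosed_closedCone S)).measurableSet

/-- Replace `y` by a nearby point `y'` of the body itself: `y + z - y'` stays in the open interior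
of the cone. -/
lemma add_mem_interior_pBody {S : Set (Fin d → ℤ)} {y z : Fin d → ℝ}
    (hy : y ∈ closure (pBody p S T)) (hz : z ∈ interior (closedCone S)) :
    y + z ∈ interior (pBody p S T) := by
  have hsub : pBody p S T + interior (closedCone S) ⊆ interior (pBody p S T) := by
    refine interior_maximal ?_ isOpen_interior.add_left
    rintro _ ⟨y, hy, z, hz, rfl⟩
    exact add_mem_pBody hy (interior_subset hz)
  have hc : Filter.Tendsto (fun y' => y + z - y') (𝓝 y) (𝓝 z) := by
    have : Continuous fun y' : Fin d → ℝ => y + z - y' := by fun_prop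
    simpa using this.tendsto y
  obtain ⟨y', hy', h⟩ := mem_closure_iff_nhds.mp hy _
    (hc.eventually (isOpen_interior.mem_nhds hz))
  exact hsub ⟨y', h, y + z - y', hy', by simp⟩

lemma tendsto_add_smul_nhdsGT (y z : Fin d → ℝ) :
    Filter.Tendsto (fun ε : ℝ => y + ε • z) (𝓝[>] 0) (𝓝 y) := by
  have h : Filter.Tendsto (fun ε : ℝ => y + ε • z) (𝓝 0) (𝓝 (y + (0 : ℝ) • z)) :=
    Continuous.tendsto (by fun_prop) 0
  simp only [zero_smul, add_zero] at h
  exact h.mono_left nhdsWithin_le_nhds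

lemma nonempty_interior_closedCone (hS : ∀ z, ∃ s ∈ S, ∃ s' ∈ S, s - s' = z) :
    (interior (closedCone (S : Set (Fin d → ℤ)))).Nonempty := by
  obtain ⟨σ, -, -, h⟩ := exists_center hS
  rw [interior_closedCone hS]
  exact ⟨toReal σ, mem_interior_conicalHull fun w hw => by simpa using h 1 w hw⟩

/-- Step back from `y` by a small interior vector of the cone, decompose there, and give the vector
back to the cone part. -/
lemma exists_of_mem_interior_pBody (hS : ∀ z, ∃ s ∈ S, ∃ s' ∈ S, s - s' = z) {y : Fin d → ℝ}
    (hy : y ∈ interior (pBody p (S : Set (Fin d → ℤ)) T)) :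
    ∃ e, ∃ u ∈ T e, ∃ z ∈ interior (closedCone (S : Set (Fin d → ℤ))),
      ((p : ℝ) ^ e)⁻¹ • toReal u + z = y := by
  obtain ⟨σ, hσ⟩ := nonempty_interior_closedCone hS
  obtain ⟨ε, hε, hε0⟩ := (((tendsto_add_smul_nhdsGT y (-σ)).eventually
    (isOpen_interior.mem_nhds hy)).and self_mem_nhdsWithin).exists
  obtain ⟨e, u, hu, z, hz, h⟩ := mem_pBody.mp (interior_subset hε)
  refine ⟨e, u, hu, z + ε • σ,
    add_mem_interior_closedCone hz (smul_mem_interior_closedCone hσ hε0), ?_⟩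
  rw [← add_assoc, h]
  simp

/-- The translates of the frontier along an interior direction of the cone are pairwise disjoint.
There are uncountably many of them, all of equal measure, so this measure is zero. -/
lemma volume_frontier_pBody (hS : ∀ z, ∃ s ∈ S, ∃ s' ∈ S, s - s' = z) :
    MeasureTheory.volume (frontier (pBody p (S : Set (Fin d → ℤ)) T)) = 0 := by
  obtain ⟨σ, hσ⟩ := nonempty_interior_closedCone hS
  set X := pBody p (S : Set (Fin d → ℤ)) T
  have hlt : ∀ s t : ℝ, s < t →
      Disjoint ((fun y => s • σ + y) ⁻¹' frontier X) ((fun y => t • σ + y) ⁻¹' frontier X) := by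
    intro s t hst
    rw [Set.disjoint_left]
    intro y hs ht
    have h1 := add_mem_interior_pBody (frontier_subset_closure hs)
      (smul_mem_interior_closedCone hσ (sub_pos.mpr hst))
    rw [show s • σ + y + (t - s) • σ = t • σ + y by module] at h1
    exact ht.2 h1
  have hdisj : Pairwise (Function.onFun Disjoint
      fun t : ℝ => (fun y => t • σ + y) ⁻¹' frontier X) := by
    intro s t hst
    rcases hst.lt_or_gt with h | h
    · exact hlt s t h
    · exact (hlt t s h).symm
  have hcount := MeasureTheory.Measure.countable_meas_pos_of_disjoint_iUnion
    (μ := MeasureTheory.volume)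
    (fun t : ℝ => (measurable_const_add (t • σ)) isClosed_frontier.measurableSet) hdisj
  simp only [MeasureTheory.measure_preimage_add] at hcount
  by_contra h
  rw [← ne_eq, ← pos_iff_ne_zero] at h
  simp only [h, Set.ofPred_true] at hcount
  exact Set.not_countable_univ hcount

/-- Near the ray of an interior point of the `p`-body, all lattice points belong to any given
translate of `T e`, for large `e`. -/
lemma IsPSystem.eventually_mem (hp : 1 < p) (hS : ∀ z, ∃ s ∈ S, ∃ s' ∈ S, s - s' = z)
    (hT : IsPSystem p S T) {y : Fin d → ℝ}
    (hy : y ∈ interior (pBody p (S : Set (Fin d → ℤ)) T)) (v : Fin d → ℤ) :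
    ∃ δ > 0, ∀ᶠ e : ℕ in Filter.atTop, ∀ u : Fin d → ℤ,
      ‖toReal u - (p : ℝ) ^ e • y‖ ≤ (p : ℝ) ^ e * δ → u - v ∈ T e := by
  obtain ⟨e₀, u₀, hu₀, z, hz, rfl⟩ := exists_of_mem_interior_pBody hS hy
  obtain ⟨δ, hδ, hev⟩ := eventually_mem_of_mem_interior hS hz
  -- The other half of `δ` absorbs the translation by `v`, which is negligible for large `e`.
  refine ⟨δ / 2, by positivity, ?_⟩
  have hp' : Filter.Tendsto (fun e => p ^ e) Filter.atTop Filter.atTop :=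
    tendsto_pow_atTop_atTop_of_one_lt hp
  have hv : ∀ᶠ e : ℕ in Filter.atTop, ‖toReal v‖ ≤ (p : ℝ) ^ e * (δ / 2) := by
    have h := (tendsto_natCast_atTop_atTop (R := ℝ)).comp hp'
    filter_upwards [(h.atTop_mul_const (half_pos hδ)).eventually_ge_atTop ‖toReal v‖] with e he
    simpa using he
  filter_upwards [hp'.eventually hev, hv, Filter.eventually_ge_atTop e₀] with e he hve hle u hu
  obtain ⟨k, rfl⟩ := Nat.exists_eq_add_of_le hle
  have hp0 : (p : ℝ) ≠ 0 := by positivity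
  -- After subtracting `p ^ k • u₀`, which lies in `T (e₀ + k)`, the rest is close to a large
  -- multiple of the interior point `z` of the cone.
  have hmem : u - v - p ^ k • u₀ ∈ S := by
    refine he _ ?_
    have : toReal (u - v - p ^ k • u₀) - ((p ^ (e₀ + k) : ℕ) : ℝ) • z =
        (toReal u - (p : ℝ) ^ (e₀ + k) • (((p : ℝ) ^ e₀)⁻¹ • toReal u₀ + z)) - toReal v := by
      have h2 : (p : ℝ) ^ (e₀ + k) • (((p : ℝ) ^ e₀)⁻¹ • toReal u₀ + z) =
          (p : ℝ) ^ k • toReal u₀ + (p : ℝ) ^ (e₀ + k) • z := by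
        rw [smul_add, smul_smul, pow_add]
        congr 2
        field_simp
      rw [h2, toReal_sub, toReal_sub, toReal_nsmul]
      push_cast
      abel
    rw [this]
    refine (norm_sub_le _ _).trans ?_
    push_cast
    linarith
  have := hT.add_mem _ _ (hT.pow_nsmul_mem hu₀ k) _ hmem
  rwa [add_sub_cancel] at this

end Body

end PBody

namespace PBody

/-! ### Counting lattice points -/

section Count

variable {d p : ℕ}

lemma finite_setOf_toReal_mem {E : Set (Fin d → ℝ)} (hE : Bornology.IsBounded E) :
    {u : Fin d → ℤ | toReal u ∈ E}.Finite := by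
  obtain ⟨R, hR⟩ := hE.exists_norm_le
  refine (Set.finite_Icc (fun _ => -⌈R⌉) (fun _ => ⌈R⌉)).subset fun u hu => ?_
  have h : ∀ i, |(u i : ℝ)| ≤ ⌈R⌉ := fun i =>
    ((norm_le_pi_norm (toReal u) i).trans (hR _ hu)).trans (Int.le_ceil R)
  constructor <;> intro i
  · exact_mod_cast (abs_le.mp (h i)).1
  · exact_mod_cast (abs_le.mp (h i)).2

lemma finite_setOf_inv_smul_toReal_mem {E : Set (Fin d → ℝ)} (hE : Bornology.IsBounded E)
    {c : ℝ} (hc : c ≠ 0) : {u : Fin d → ℤ | c⁻¹ • toReal u ∈ E}.Finite := by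
  refine (finite_setOf_toReal_mem (hE.smul₀ c)).subset fun u hu => ?_
  exact ⟨_, hu, smul_inv_smul₀ hc _⟩

lemma natCard_inter_smul_span (E : Set (Fin d → ℝ)) (n : ℕ) (hn : n ≠ 0) :
    Nat.card ↑(E ∩ (n : ℝ)⁻¹ •
      (Submodule.span ℤ (Set.range (Pi.basisFun ℝ (Fin d))) : Set (Fin d → ℝ))) =
      {u : Fin d → ℤ | (n : ℝ)⁻¹ • toReal u ∈ E}.ncard := by
  have hn' : (n : ℝ) ≠ 0 := by exact_mod_cast hn
  have hinj : Function.Injective fun u : Fin d → ℤ => (n : ℝ)⁻¹ • toReal u :=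
    (smul_right_injective _ (inv_ne_zero hn')).comp toReal_injective
  rw [← Set.ncard_image_of_injective _ hinj, Nat.card_coe_set_eq]
  congr 1
  ext y
  constructor
  · rintro ⟨hy, x, hx, rfl⟩
    have hx' := (Pi.basisFun ℝ (Fin d)).mem_span_iff_repr_mem ℤ x |>.mp hx
    choose u hu using hx'
    have : toReal u = x := by
      ext i
      simpa using hu i
    exact ⟨u, by simpa [this] using hy, by simp [this]⟩
  · rintro ⟨u, hu, rfl⟩
    refine ⟨hu, toReal u, ?_, rfl⟩
    refine ((Pi.basisFun ℝ (Fin d)).mem_span_iff_repr_mem ℤ _).mpr fun i => ⟨u i, by simp⟩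

lemma tendsto_ncard_lattice_div {E : Set (Fin d → ℝ)} (hb : Bornology.IsBounded E)
    (hm : MeasurableSet E) (hf : MeasureTheory.volume (frontier E) = 0) (hp : 1 < p) :
    Filter.Tendsto (fun e : ℕ =>
      ({u : Fin d → ℤ | ((p : ℝ) ^ e)⁻¹ • toReal u ∈ E}.ncard : ℝ) / ((p : ℝ) ^ e) ^ d)
      Filter.atTop (𝓝 (MeasureTheory.volume.real E)) := by
  refine ((tendsto_card_div_pow_atTop_volume E hb hm hf).comp
    (tendsto_pow_atTop_atTop_of_one_lt hp)).congr fun e => ?_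
  have : p ^ e ≠ 0 := by positivity
  simp only [Function.comp_apply]
  rw [natCard_inter_smul_span E _ this]
  simp

/-- Inner regularity gives a compact set, which is then enlarged inside `U` to a finite union of
closed balls; these are convex, hence have null frontier, so that lattice points can be counted. -/
lemma exists_jordan_between {U : Set (Fin d → ℝ)} (hU : IsOpen U) {r : ℝ≥0∞}
    (hr : r < MeasureTheory.volume U) :
    ∃ K ⊆ U, IsCompact K ∧ MeasureTheory.volume (frontier K) = 0 ∧
      r < MeasureTheory.volume K := by
  obtain ⟨K, hKU, hK, hrK⟩ := hU.exists_lt_isCompact hr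
  have hball : ∀ x ∈ K, ∃ ε > 0, Metric.closedBall x ε ⊆ U := fun x hx =>
    Metric.nhds_basis_closedBall.mem_iff.mp (hU.mem_nhds (hKU hx))
  choose! ε hε hεU using hball
  obtain ⟨t, ht⟩ := hK.elim_nhds_subcover' (fun x _ => Metric.closedBall x (ε x))
    fun x hx => Metric.closedBall_mem_nhds x (hε x hx)
  refine ⟨⋃ x ∈ t, Metric.closedBall (x : Fin d → ℝ) (ε x),
    Set.iUnion₂_subset fun x _ => hεU x x.2,
    t.isCompact_biUnion fun x _ => isCompact_closedBall _ _, ?_,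
    hrK.trans_le (MeasureTheory.measure_mono ht)⟩
  have hfr : ∀ t : Finset K,
      frontier (⋃ x ∈ t, Metric.closedBall (x : Fin d → ℝ) (ε x)) ⊆
        ⋃ x ∈ t, frontier (Metric.closedBall (x : Fin d → ℝ) (ε x)) := by
    classical
    intro t
    induction t using Finset.induction_on with
    | empty => simp
    | insert x t hx ih =>
      rw [Finset.set_biUnion_insert, Finset.set_biUnion_insert]
      refine (frontier_union_subset _ _).trans (Set.union_subset_union ?_ ?_)
      · exact Set.inter_subset_left
      · exact Set.inter_subset_right.trans ih
  refine MeasureTheory.measure_mono_null (hfr t) ?_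
  exact (MeasureTheory.measure_biUnion_null_iff t.countable_toSet).mpr
    fun x _ => (convex_closedBall _ _).addHaar_frontier _

/-- A family of sets of lattice points that lie in the dilations of a Jordan measurable set `E` and
fill these dilations near every interior ray has as many elements as the volume of `E` predicts. -/
lemma tendsto_ncard_div {E : Set (Fin d → ℝ)} (hb : Bornology.IsBounded E)
    (hm : MeasurableSet E) (hf : MeasureTheory.volume (frontier E) = 0) (hp : 1 < p)
    {G : ℕ → Set (Fin d → ℤ)} (hG : ∀ e, ∀ u ∈ G e, ((p : ℝ) ^ e)⁻¹ • toReal u ∈ E)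
    (hint : ∀ y ∈ interior E, ∃ δ > 0, ∀ᶠ e : ℕ in Filter.atTop, ∀ u : Fin d → ℤ,
      ‖toReal u - (p : ℝ) ^ e • y‖ ≤ (p : ℝ) ^ e * δ → u ∈ G e) :
    Filter.Tendsto (fun e : ℕ => ((G e).ncard : ℝ) / ((p : ℝ) ^ e) ^ d)
      Filter.atTop (𝓝 (MeasureTheory.volume.real E)) := by
  have hp0 : ∀ e : ℕ, 0 < (p : ℝ) ^ e := fun e => by positivity
  have hfin : ∀ e, {u : Fin d → ℤ | ((p : ℝ) ^ e)⁻¹ • toReal u ∈ E}.Finite := fun e =>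
    finite_setOf_inv_smul_toReal_mem hb (hp0 e).ne'
  have hEtop : MeasureTheory.volume E ≠ ⊤ := hb.measure_lt_top.ne
  refine tendsto_order.mpr ⟨fun c hc => ?_, fun c hc => ?_⟩
  · have hintE : MeasureTheory.volume E = MeasureTheory.volume (interior E) := by
      refine le_antisymm ?_ (MeasureTheory.measure_mono interior_subset)
      have : E ⊆ interior E ∪ frontier E := by
        rw [← closure_eq_interior_union_frontier]; exact subset_closure
      refine (MeasureTheory.measure_mono this).trans
        ((MeasureTheory.measure_union_le _ _).trans ?_)
      rw [hf, add_zero]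
    by_cases hc0 : c < 0
    · exact Filter.Eventually.of_forall fun e => hc0.trans_le (by positivity)
    rw [MeasureTheory.measureReal_def, ← ENNReal.ofReal_lt_iff_lt_toReal (not_lt.mp hc0) hEtop,
      hintE] at hc
    obtain ⟨K, hKE, hK, hKf, hcK⟩ := exists_jordan_between isOpen_interior hc
    have hcK' : c < MeasureTheory.volume.real K := by
      rwa [MeasureTheory.measureReal_def,
        ← ENNReal.ofReal_lt_iff_lt_toReal (not_lt.mp hc0) hK.measure_lt_top.ne]
    have hsub : ∀ᶠ e : ℕ in Filter.atTop,
        {u : Fin d → ℤ | ((p : ℝ) ^ e)⁻¹ • toReal u ∈ K} ⊆ G e := by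
      -- Compactness of `K` reduces the pointwise thresholds on `e` to finitely many.
      choose! δ hδ hev using hint
      obtain ⟨t, ht⟩ := hK.elim_nhds_subcover' (fun x _ => Metric.closedBall x (δ x))
        fun x hx => Metric.closedBall_mem_nhds x (hδ x (hKE hx))
      have hall : ∀ᶠ e : ℕ in Filter.atTop, ∀ x ∈ t, ∀ u : Fin d → ℤ,
          ‖toReal u - (p : ℝ) ^ e • (x : Fin d → ℝ)‖ ≤ (p : ℝ) ^ e * δ x → u ∈ G e :=
        (Filter.eventually_all_finset t).mpr fun x _ => hev x (hKE x.2)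
      filter_upwards [hall] with e he u hu
      obtain ⟨x, hx⟩ := Set.mem_iUnion.mp (ht hu)
      obtain ⟨hxt, hx⟩ := Set.mem_iUnion.mp hx
      refine he x hxt u ?_
      rw [Metric.mem_closedBall, dist_eq_norm] at hx
      have : toReal u - (p : ℝ) ^ e • (x : Fin d → ℝ) =
          (p : ℝ) ^ e • (((p : ℝ) ^ e)⁻¹ • toReal u - (x : Fin d → ℝ)) := by
        rw [smul_sub, smul_inv_smul₀ (hp0 e).ne']
      rw [this, norm_smul, Real.norm_of_nonneg (hp0 e).le]
      exact mul_le_mul_of_nonneg_left hx (hp0 e).le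
    filter_upwards [hsub, (tendsto_order.mp (tendsto_ncard_lattice_div hK.isBounded
      hK.measurableSet hKf hp)).1 c hcK'] with e he hce
    refine hce.trans_le ?_
    gcongr
    exact (hfin e).subset fun u hu => hG e u hu
  · filter_upwards [(tendsto_order.mp (tendsto_ncard_lattice_div hb hm hf hp)).2 c hc] with e he
    refine lt_of_le_of_lt ?_ he
    gcongr
    · exact hfin e
    · exact fun u hu => hG e u hu

end Count

/-! ### Truncations -/

section Truncation

variable {d p : ℕ} {S : AddSubmonoid (Fin d → ℤ)} {T : ℕ → Set (Fin d → ℤ)} {a : Fin d → ℝ}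

lemma weight_eq (a : Fin d → ℝ) (u : Fin d → ℤ) : weight a u = a ⬝ᵥ toReal u := rfl

/-- The minimum `m` of `⟨a, y⟩` on the compact unit slice of the cone is positive, and homogeneity
gives `m * ‖y‖ ≤ ⟨a, y⟩` on the whole cone. -/
lemma isBounded_closedCone_inter {S : Set (Fin d → ℤ)}
    (ha : ∀ u ∈ closedCone S, u ≠ 0 → 0 < a ⬝ᵥ u) (α : ℝ) :
    Bornology.IsBounded (closedCone S ∩ {y | a ⬝ᵥ y < α}) := by
  have hcont : Continuous fun y : Fin d → ℝ => a ⬝ᵥ y := by fun_prop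
  have hcomp : IsCompact (Metric.sphere (0 : Fin d → ℝ) 1 ∩ closedCone S) :=
    (isCompact_sphere _ _).inter_right (isClosed_closedCone S)
  have hm : ∃ m > 0, ∀ y ∈ closedCone S, m * ‖y‖ ≤ a ⬝ᵥ y := by
    have hmin : ∃ m > 0, ∀ y ∈ Metric.sphere (0 : Fin d → ℝ) 1 ∩ closedCone S, m ≤ a ⬝ᵥ y := by
      rcases (Metric.sphere (0 : Fin d → ℝ) 1 ∩ closedCone S).eq_empty_or_nonempty with h | h
      · exact ⟨1, one_pos, by simp [h]⟩
      · obtain ⟨y₀, hy₀, hmin⟩ := hcomp.exists_isMinOn h hcont.continuousOn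
        refine ⟨a ⬝ᵥ y₀, ha _ hy₀.2 ?_, fun y hy => hmin hy⟩
        rintro rfl
        simpa using hy₀.1
    obtain ⟨m, hm, h⟩ := hmin
    refine ⟨m, hm, fun y hy => ?_⟩
    by_cases hy0 : y = 0
    · simp [hy0]
    have hn : 0 < ‖y‖ := norm_pos_iff.mpr hy0
    have := h (‖y‖⁻¹ • y) ⟨by simp [norm_smul, hn.ne'], smul_mem_closedCone hy (by positivity)⟩
    rw [dotProduct_smul, smul_eq_mul, le_inv_mul_iff₀ hn] at this
    linarith
  obtain ⟨m, hm, h⟩ := hm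
  refine (Metric.isBounded_closedBall (x := (0 : Fin d → ℝ)) (r := α / m)).subset ?_
  rintro y ⟨hy, hyα⟩
  rw [mem_closedBall_zero_iff, le_div_iff₀ hm]
  have := h y hy
  have h2 : a ⬝ᵥ y < α := hyα
  linarith

lemma finite_setOf_weight_lt (ha : ∀ u ∈ closedCone (S : Set (Fin d → ℤ)), u ≠ 0 → 0 < a ⬝ᵥ u)
    (t : ℝ) : {u | u ∈ S ∧ weight a u < t}.Finite :=
  (finite_setOf_toReal_mem (isBounded_closedCone_inter ha t)).subset fun _ hu =>
    ⟨toReal_mem_closedCone hu.1, hu.2⟩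

lemma measurableSet_halfspace (a : Fin d → ℝ) (α : ℝ) : MeasurableSet {y | a ⬝ᵥ y < α} :=
  (isOpen_lt (by fun_prop) continuous_const).measurableSet

lemma convex_halfspace (a : Fin d → ℝ) (α : ℝ) : Convex ℝ {y | a ⬝ᵥ y < α} :=
  convex_halfSpace_lt ⟨dotProduct_add a, fun c x => dotProduct_smul c a x⟩ α

lemma volume_frontier_pBody_inter (hS : ∀ z, ∃ s ∈ S, ∃ s' ∈ S, s - s' = z) (α : ℝ) :
    MeasureTheory.volume
      (frontier (pBody p (S : Set (Fin d → ℤ)) T ∩ {y | a ⬝ᵥ y < α})) = 0 := by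
  refine MeasureTheory.measure_mono_null ((frontier_inter_subset _ _).trans
    (Set.union_subset_union Set.inter_subset_left Set.inter_subset_right)) ?_
  exact MeasureTheory.measure_union_null (volume_frontier_pBody hS)
    ((convex_halfspace a α).addHaar_frontier _)

lemma IsPSystem.isBounded_inter (hT : IsPSystem p S T)
    (ha : ∀ u ∈ closedCone (S : Set (Fin d → ℤ)), u ≠ 0 → 0 < a ⬝ᵥ u) (α : ℝ) :
    Bornology.IsBounded (pBody p (S : Set (Fin d → ℤ)) T ∩ {y | a ⬝ᵥ y < α}) :=
  (isBounded_closedCone_inter ha α).subset (Set.inter_subset_inter_left _ hT.pBody_subset)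

/-- The number of points of weight less than `q * α` in a `p`-system, even if restricted to those
of a translate of it, is asymptotically the volume of a truncation of the `p`-body. -/
lemma IsPSystem.tendsto_ncard (hp : 1 < p) (hS : ∀ z, ∃ s ∈ S, ∃ s' ∈ S, s - s' = z)
    (hT : IsPSystem p S T)
    (ha : ∀ u ∈ closedCone (S : Set (Fin d → ℤ)), u ≠ 0 → 0 < a ⬝ᵥ u) (α : ℝ) (v : Fin d → ℤ) :
    Filter.Tendsto (fun e : ℕ =>
      ({u | u ∈ T e ∧ u - v ∈ T e ∧ weight a u < (p : ℝ) ^ e * α}.ncard : ℝ) / ((p : ℝ) ^ e) ^ d)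
      Filter.atTop
      (𝓝 (MeasureTheory.volume.real
        (pBody p (S : Set (Fin d → ℤ)) T ∩ {y | a ⬝ᵥ y < α}))) := by
  have hp0 : ∀ e : ℕ, 0 < (p : ℝ) ^ e := fun e => by positivity
  have hw : ∀ (e : ℕ) (u : Fin d → ℤ),
      a ⬝ᵥ (((p : ℝ) ^ e)⁻¹ • toReal u) < α ↔ weight a u < (p : ℝ) ^ e * α := fun e u => by
    rw [dotProduct_smul, smul_eq_mul, inv_mul_lt_iff₀ (hp0 e), weight_eq]
  refine tendsto_ncard_div (hT.isBounded_inter ha α)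
    ((measurableSet_pBody _).inter (measurableSet_halfspace a α))
    (volume_frontier_pBody_inter hS α) hp
    (fun e u hu => ⟨inv_pow_smul_mem_pBody hu.1, (hw e u).mpr hu.2.2⟩) fun y hy => ?_
  rw [interior_inter] at hy
  obtain ⟨δ₁, hδ₁, h₁⟩ := hT.eventually_mem hp hS hy.1 v
  obtain ⟨δ₂, hδ₂, h₂⟩ := hT.eventually_mem hp hS hy.1 0
  obtain ⟨δ₃, hδ₃, h₃⟩ := Metric.nhds_basis_closedBall.mem_iff.mp
    (mem_interior_iff_mem_nhds.mp hy.2)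
  refine ⟨min δ₁ (min δ₂ δ₃), by positivity, ?_⟩
  filter_upwards [h₁, h₂] with e he₁ he₂ u hu
  have hle : ∀ δ, min δ₁ (min δ₂ δ₃) ≤ δ →
      ‖toReal u - (p : ℝ) ^ e • y‖ ≤ (p : ℝ) ^ e * δ := fun δ h =>
    hu.trans (mul_le_mul_of_nonneg_left h (hp0 e).le)
  refine ⟨by simpa using he₂ u (hle δ₂ (by simp)), he₁ u (hle δ₁ (by simp)), ?_⟩
  rw [← hw]
  refine h₃ ?_
  rw [Metric.mem_closedBall, dist_eq_norm]
  have : ((p : ℝ) ^ e)⁻¹ • toReal u - y =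
      ((p : ℝ) ^ e)⁻¹ • (toReal u - (p : ℝ) ^ e • y) := by
    rw [smul_sub, inv_smul_smul₀ (hp0 e).ne']
  rw [this, norm_smul, norm_inv, Real.norm_of_nonneg (hp0 e).le, inv_mul_le_iff₀ (hp0 e)]
  exact hle δ₃ (by simp)

end Truncation

end PBody

namespace PBody

/-! ### Agreement of nested `p`-bodies outside of a truncation -/

section Agreement

variable {d p : ℕ} {S : AddSubmonoid (Fin d → ℤ)} {T T' : ℕ → Set (Fin d → ℤ)} {a : Fin d → ℝ}
  {α : ℝ}

lemma tendsto_inv_smul_floor {q : ℕ → ℝ} (hq : Filter.Tendsto q Filter.atTop Filter.atTop)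
    (y : Fin d → ℝ) :
    Filter.Tendsto (fun e => (q e)⁻¹ • toReal fun i => ⌊q e * y i⌋) Filter.atTop (𝓝 y) := by
  refine tendsto_pi_nhds.mpr fun i => ?_
  rw [tendsto_iff_norm_sub_tendsto_zero]
  refine squeeze_zero' (Filter.Eventually.of_forall fun _ => norm_nonneg _) ?_
    hq.inv_tendsto_atTop
  filter_upwards [hq.eventually_gt_atTop 0] with e he
  have h1 := Int.floor_le (q e * y i)
  have h2 := Int.lt_floor_add_one (q e * y i)
  have h3 : ((q e)⁻¹ • toReal fun i => ⌊q e * y i⌋) i - y i =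
      (q e)⁻¹ * (⌊q e * y i⌋ - q e * y i) := by
    simp only [Pi.smul_apply, toReal_apply, smul_eq_mul]
    field_simp
  rw [h3, norm_mul, norm_inv, Real.norm_of_nonneg he.le, Pi.inv_apply]
  refine mul_le_of_le_one_right (by positivity) ?_
  rw [Real.norm_eq_abs, abs_le]
  constructor <;> linarith

/-- If two nested `p`-systems have the same elements of weight at least `q * α`, the interior
points of weight greater than `α` of the larger `p`-body belong to the smaller one. -/
lemma IsPSystem.mem_pBody_of_mem_interior (hp : 1 < p)
    (hS : ∀ z, ∃ s ∈ S, ∃ s' ∈ S, s - s' = z) (hT' : IsPSystem p S T')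
    (hagree : ∀ e, ∀ u ∈ T' e, (p : ℝ) ^ e * α ≤ weight a u → u ∈ T e) {y : Fin d → ℝ}
    (hy : y ∈ interior (pBody p (S : Set (Fin d → ℤ)) T')) (hα : α < a ⬝ᵥ y) :
    y ∈ pBody p (S : Set (Fin d → ℤ)) T := by
  have hp0 : ∀ e : ℕ, 0 < (p : ℝ) ^ e := fun e => by positivity
  have hcont : Continuous fun y : Fin d → ℝ => a ⬝ᵥ y := by fun_prop
  obtain ⟨σ, hσ⟩ := nonempty_interior_closedCone hS
  -- Retract `y` to `x = y - ε • σ`, still interior and of weight above `α`. Rounding `q * x` gives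
  -- `u ∈ T' e` of weight at least `q * α`, and `y - u / q` is close to `ε • σ`, hence in the cone.
  obtain ⟨ε, ⟨hε, hεα⟩, hε0⟩ := (((tendsto_add_smul_nhdsGT y (-σ)).eventually
    ((isOpen_interior.inter (isOpen_lt continuous_const hcont)).mem_nhds ⟨hy, hα⟩)).and
      self_mem_nhdsWithin).exists
  replace hεα : α < a ⬝ᵥ (y + ε • -σ) := hεα
  set x := y + ε • -σ with hx
  obtain ⟨δ, hδ, hev⟩ := hT'.eventually_mem hp hS hε 0
  have hpow : Filter.Tendsto (fun e : ℕ => (p : ℝ) ^ e) Filter.atTop Filter.atTop :=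
    tendsto_pow_atTop_atTop_of_one_lt (by exact_mod_cast hp)
  have hlim := tendsto_inv_smul_floor hpow x
  have hlim' : Filter.Tendsto (fun e => y - ((p : ℝ) ^ e)⁻¹ • toReal fun i => ⌊(p : ℝ) ^ e * x i⌋)
      Filter.atTop (𝓝 (ε • σ)) := by
    have := hlim.const_sub y
    rwa [hx, show y - (y + ε • -σ) = ε • σ by module] at this
  obtain ⟨e, hmem, hw, hball, hcone⟩ := (hev.and
    ((hlim.eventually ((isOpen_lt continuous_const hcont).mem_nhds hεα)).and
      ((hlim.eventually (Metric.closedBall_mem_nhds x hδ)).and (hlim'.eventually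
        (isOpen_interior.mem_nhds (smul_mem_interior_closedCone hσ hε0)))))).exists
  set u : Fin d → ℤ := fun i => ⌊(p : ℝ) ^ e * x i⌋
  have hu : u ∈ T' e := by
    have := hmem u ?_
    · simpa using this
    rw [dist_eq_norm] at hball
    have h2 : toReal u - (p : ℝ) ^ e • x =
        (p : ℝ) ^ e • (((p : ℝ) ^ e)⁻¹ • toReal u - x) := by
      rw [smul_sub, smul_inv_smul₀ (hp0 e).ne']
    rw [h2, norm_smul, Real.norm_of_nonneg (hp0 e).le]
    exact mul_le_mul_of_nonneg_left hball (hp0 e).le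
  refine mem_pBody.mpr ⟨e, u, hagree e u hu ?_, _, interior_subset hcone, by abel⟩
  replace hw : α < a ⬝ᵥ (((p : ℝ) ^ e)⁻¹ • toReal u) := hw
  rw [dotProduct_smul, smul_eq_mul, lt_inv_mul_iff₀ (hp0 e)] at hw
  exact hw.le

lemma closure_pBody_subset (hT : IsPSystem p S T) :
    closure (pBody p (S : Set (Fin d → ℤ)) T) ⊆ closedCone S :=
  closure_minimal hT.pBody_subset (isClosed_closedCone _)

/-- The slack 1 yields a strict inequality, an open condition stable under small perturbations. -/
lemma lt_of_notMem_truncation {C : Set (Fin d → ℝ)} {y : Fin d → ℝ} (hy : y ∈ C)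
    (h : y ∉ C ∩ {y | a ⬝ᵥ y < α + 1}) : α < a ⬝ᵥ y := by
  by_contra! hle
  exact h ⟨hy, show a ⬝ᵥ y < α + 1 by linarith⟩

lemma IsPSystem.interior_diff_eq (hp : 1 < p) (hS : ∀ z, ∃ s ∈ S, ∃ s' ∈ S, s - s' = z)
    (hT' : IsPSystem p S T') (hTT : ∀ e, T e ⊆ T' e)
    (hagree : ∀ e, ∀ u ∈ T' e, (p : ℝ) ^ e * α ≤ weight a u → u ∈ T e) :
    interior (pBody p (S : Set (Fin d → ℤ)) T) \
        (closedCone (S : Set (Fin d → ℤ)) ∩ {y | a ⬝ᵥ y < α + 1}) =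
      interior (pBody p (S : Set (Fin d → ℤ)) T') \
        (closedCone (S : Set (Fin d → ℤ)) ∩ {y | a ⬝ᵥ y < α + 1}) := by
  refine Set.Subset.antisymm
    (Set.sdiff_subset_sdiff_left (interior_mono (pBody_mono hTT))) fun y hy => ⟨?_, hy.2⟩
  have hlt := lt_of_notMem_truncation (hT'.pBody_subset (interior_subset hy.1)) hy.2
  have hcont : Continuous fun y : Fin d → ℝ => a ⬝ᵥ y := by fun_prop
  exact mem_interior.mpr ⟨interior (pBody p (S : Set (Fin d → ℤ)) T') ∩ {y | α < a ⬝ᵥ y},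
    fun z hz => hT'.mem_pBody_of_mem_interior hp hS hagree hz.1 hz.2,
    isOpen_interior.inter (isOpen_lt continuous_const hcont), hy.1, hlt⟩

/-- A point of the closure is pushed into the interior by `ε • σ`, where the bodies agree; then `ε`
tends to zero. -/
lemma IsPSystem.closure_diff_eq (hp : 1 < p) (hS : ∀ z, ∃ s ∈ S, ∃ s' ∈ S, s - s' = z)
    (hT' : IsPSystem p S T') (hTT : ∀ e, T e ⊆ T' e)
    (hagree : ∀ e, ∀ u ∈ T' e, (p : ℝ) ^ e * α ≤ weight a u → u ∈ T e) :
    closure (pBody p (S : Set (Fin d → ℤ)) T) \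
        (closedCone (S : Set (Fin d → ℤ)) ∩ {y | a ⬝ᵥ y < α + 1}) =
      closure (pBody p (S : Set (Fin d → ℤ)) T') \
        (closedCone (S : Set (Fin d → ℤ)) ∩ {y | a ⬝ᵥ y < α + 1}) := by
  refine Set.Subset.antisymm
    (Set.sdiff_subset_sdiff_left (closure_mono (pBody_mono hTT))) fun y hy => ⟨?_, hy.2⟩
  have hlt := lt_of_notMem_truncation (closure_pBody_subset hT' hy.1) hy.2
  have hcont : Continuous fun y : Fin d → ℝ => a ⬝ᵥ y := by fun_prop
  obtain ⟨σ, hσ⟩ := nonempty_interior_closedCone hS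
  refine mem_closure_of_tendsto (tendsto_add_smul_nhdsGT y σ) ?_
  filter_upwards [(tendsto_add_smul_nhdsGT y σ).eventually
    ((isOpen_lt continuous_const hcont).mem_nhds hlt), self_mem_nhdsWithin] with ε hε hε0
  exact hT'.mem_pBody_of_mem_interior hp hS hagree
    (add_mem_interior_pBody hy.1 (smul_mem_interior_closedCone hσ hε0)) hε

/-- The set lies in the frontier of the larger body. -/
lemma IsPSystem.volume_diff_eq_zero (hp : 1 < p) (hS : ∀ z, ∃ s ∈ S, ∃ s' ∈ S, s - s' = z)
    (hT' : IsPSystem p S T')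
    (hagree : ∀ e, ∀ u ∈ T' e, (p : ℝ) ^ e * α ≤ weight a u → u ∈ T e) :
    MeasureTheory.volume ((pBody p (S : Set (Fin d → ℤ)) T' \ pBody p (S : Set (Fin d → ℤ)) T) \
        (closedCone (S : Set (Fin d → ℤ)) ∩ {y | a ⬝ᵥ y < α + 1})) = 0 := by
  refine MeasureTheory.measure_mono_null (fun y hy => ?_) 
    (volume_frontier_pBody (p := p) (T := T') hS)
  refine ⟨subset_closure hy.1.1, fun hint => hy.1.2 ?_⟩
  exact hT'.mem_pBody_of_mem_interior hp hS hagree hint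
    (lt_of_notMem_truncation (hT'.pBody_subset hy.1.1) hy.2)

/-- When the conical hull is closed, the cone part `z` of a boundary point is itself a conical
combination. It is thus a limit of points `s k / q` with `s k ∈ S` and remainder in the cone, and no
interior point is needed. -/
lemma IsPSystem.diff_eq_of_isClosed (hp : 1 < p)
    (hT' : IsPSystem p S T') (hTT : ∀ e, T e ⊆ T' e)
    (hagree : ∀ e, ∀ u ∈ T' e, (p : ℝ) ^ e * α ≤ weight a u → u ∈ T e)
    (hC : IsClosed (conicalHull (S : Set (Fin d → ℤ)))) :
    pBody p (S : Set (Fin d → ℤ)) T \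
        (closedCone (S : Set (Fin d → ℤ)) ∩ {y | a ⬝ᵥ y < α + 1}) =
      pBody p (S : Set (Fin d → ℤ)) T' \
        (closedCone (S : Set (Fin d → ℤ)) ∩ {y | a ⬝ᵥ y < α + 1}) := by
  refine Set.Subset.antisymm
    (Set.sdiff_subset_sdiff_left (pBody_mono hTT)) fun y hy => ⟨?_, hy.2⟩
  have hlt := lt_of_notMem_truncation (hT'.pBody_subset hy.1) hy.2
  have hcont : Continuous fun y : Fin d → ℝ => a ⬝ᵥ y := by fun_prop
  obtain ⟨e, u, hu, z, hz, rfl⟩ := mem_pBody.mp hy.1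
  obtain ⟨B, hB⟩ := exists_approx_of_mem_conicalHull (S := S) (hC.closure_eq.subset hz)
  choose s hs hsB hsC using fun k : ℕ => hB ((p : ℝ) ^ (e + k)) (by positivity)
  have hp0 : ∀ e : ℕ, 0 < (p : ℝ) ^ e := fun e => by positivity
  have hpow : Filter.Tendsto (fun k : ℕ => (p : ℝ) ^ (e + k)) Filter.atTop Filter.atTop :=
    (tendsto_pow_atTop_atTop_of_one_lt (by exact_mod_cast hp)).comp (Filter.tendsto_add_atTop_nat e
      |>.congr fun k => add_comm k e)
  have hdiff : ∀ k, ‖((p : ℝ) ^ (e + k))⁻¹ • toReal (s k) - z‖ ≤ ((p : ℝ) ^ (e + k))⁻¹ * B := by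
    intro k
    have : ((p : ℝ) ^ (e + k))⁻¹ • toReal (s k) - z =
        -(((p : ℝ) ^ (e + k))⁻¹ • ((p : ℝ) ^ (e + k) • z - toReal (s k))) := by
      rw [smul_sub, inv_smul_smul₀ (hp0 _).ne']; abel
    rw [this, norm_neg, norm_smul, norm_inv, Real.norm_of_nonneg (hp0 _).le]
    exact mul_le_mul_of_nonneg_left (hsB k) (by positivity)
  have hlim : Filter.Tendsto (fun k => ((p : ℝ) ^ (e + k))⁻¹ • toReal (s k)) Filter.atTop
      (𝓝 z) := by
    rw [tendsto_iff_norm_sub_tendsto_zero]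
    refine squeeze_zero (fun _ => norm_nonneg _) hdiff ?_
    simpa using hpow.inv_tendsto_atTop.mul_const B
  obtain ⟨k, hk⟩ := ((hlim.const_add (((p : ℝ) ^ e)⁻¹ • toReal u)).eventually
    ((isOpen_lt continuous_const hcont).mem_nhds hlt)).exists
  have hpt : ((p : ℝ) ^ (e + k))⁻¹ • toReal (p ^ k • u + s k) =
      ((p : ℝ) ^ e)⁻¹ • toReal u + ((p : ℝ) ^ (e + k))⁻¹ • toReal (s k) := by
    rw [toReal_add, toReal_nsmul, smul_add, smul_smul]
    congr 2
    have := hp0 e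
    have := hp0 k
    push_cast
    rw [pow_add]
    field_simp
  refine mem_pBody.mpr ⟨e + k, p ^ k • u + s k, hagree _ _
    (hT'.add_mem _ _ (hT'.pow_nsmul_mem hu k) _ (hs k)) ?_,
    ((p : ℝ) ^ (e + k))⁻¹ • ((p : ℝ) ^ (e + k) • z - toReal (s k)),
    smul_mem_closedCone (subset_closure (hsC k)) (by positivity), ?_⟩
  · replace hk : α < a ⬝ᵥ (((p : ℝ) ^ e)⁻¹ • toReal u +
      ((p : ℝ) ^ (e + k))⁻¹ • toReal (s k)) := hk
    rw [← hpt, dotProduct_smul, smul_eq_mul, lt_inv_mul_iff₀ (hp0 _)] at hk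
    exact hk.le
  · rw [hpt, smul_sub, inv_smul_smul₀ (hp0 _).ne']
    abel

/-- The volume of the difference of the `p`-bodies of two nested `p`-systems with the same elements
of weight at least `q * α`. -/
lemma IsPSystem.volume_diff (hp : 1 < p) (hS : ∀ z, ∃ s ∈ S, ∃ s' ∈ S, s - s' = z)
    (ha : ∀ u ∈ closedCone (S : Set (Fin d → ℤ)), u ≠ 0 → 0 < a ⬝ᵥ u)
    (hT : IsPSystem p S T) (hT' : IsPSystem p S T') (hTT : ∀ e, T e ⊆ T' e)
    (hagree : ∀ e, ∀ u ∈ T' e, (p : ℝ) ^ e * α ≤ weight a u → u ∈ T e) :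
    MeasureTheory.volume (pBody p (S : Set (Fin d → ℤ)) T' \ pBody p (S : Set (Fin d → ℤ)) T) =
      MeasureTheory.volume (pBody p (S : Set (Fin d → ℤ)) T' ∩ {y | a ⬝ᵥ y < α + 1}) -
      MeasureTheory.volume (pBody p (S : Set (Fin d → ℤ)) T ∩ {y | a ⬝ᵥ y < α + 1}) := by
  have hm := (measurableSet_pBody (p := p) (T := T) (S : Set (Fin d → ℤ))).inter
    (measurableSet_halfspace a (α + 1))
  rw [← MeasureTheory.measure_sdiff (Set.inter_subset_inter_left _ (pBody_mono hTT))
    hm.nullMeasurableSet (hT.isBounded_inter ha _).measure_lt_top.ne]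
  refine le_antisymm ?_ (MeasureTheory.measure_mono ?_)
  -- Below `α + 1` the points lie in the difference of the truncated bodies; the others form a null
  -- set.
  · refine (MeasureTheory.measure_mono (fun y hy => ?_)).trans
      ((MeasureTheory.measure_union_le _ _).trans_eq
        ((congrArg _ (hT'.volume_diff_eq_zero hp hS hagree)).trans (add_zero _)))
    by_cases h : a ⬝ᵥ y < α + 1
    · exact Or.inl ⟨⟨hy.1, h⟩, fun h' => hy.2 h'.1⟩
    · exact Or.inr ⟨hy, fun h' => h h'.2⟩
  · rintro y ⟨⟨h1, h2⟩, h3⟩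
    exact ⟨h1, fun h => h3 ⟨h, h2⟩⟩

end Agreement

end PBody

namespace PBody

/-! ### Relative lengths of submodules -/

section RelLength

variable {R A B : Type*} [CommRing R] [AddCommGroup A] [Module R A] [AddCommGroup B] [Module R B]

/-- The length of the quotient `M / (N ∩ M)` of two submodules. -/
noncomputable def relLength (N M : Submodule R A) : ℕ∞ := Module.length R (M ⧸ N.submoduleOf M)

lemma relLength_eq_zero {N M : Submodule R A} (h : M ≤ N) : relLength N M = 0 := by
  rw [relLength, Submodule.submoduleOf_eq_top.mpr h]
  exact Module.length_eq_zero

lemma relLength_le_of_map (φ : A →ₗ[R] B) {N M : Submodule R A} {N' M' : Submodule R B}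
    (hM : M ≤ M'.comap φ) (hN : ∀ x ∈ M, x ∈ N ↔ φ x ∈ N') :
    relLength N M ≤ relLength N' M' := by
  have hle : N.submoduleOf M ≤ (N'.submoduleOf M').comap (φ.restrict hM) :=
    fun x hx => (hN x x.2).mp hx
  refine Module.length_le_of_injective (Submodule.mapQ _ _ (φ.restrict hM) hle) ?_
  rw [← LinearMap.ker_eq_bot, Submodule.ker_mapQ, ← le_bot_iff,
    Submodule.map_le_iff_le_comap]
  exact fun x hx => (Submodule.Quotient.mk_eq_zero _).mpr ((hN x x.2).mpr hx)

lemma relLength_eq_of_map (φ : A →ₗ[R] B) {N M : Submodule R A} {N' M' : Submodule R B}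
    (hM : M ≤ M'.comap φ) (hN : ∀ x ∈ M, x ∈ N ↔ φ x ∈ N')
    (hsurj : ∀ y ∈ M', ∃ x ∈ M, y - φ x ∈ N') :
    relLength N M = relLength N' M' := by
  refine le_antisymm (relLength_le_of_map φ hM hN) ?_
  have hle : N.submoduleOf M ≤ (N'.submoduleOf M').comap (φ.restrict hM) :=
    fun x hx => (hN x x.2).mp hx
  refine Module.length_le_of_surjective (Submodule.mapQ _ _ (φ.restrict hM) hle) fun y => ?_
  obtain ⟨y, rfl⟩ := Submodule.mkQ_surjective _ y
  obtain ⟨x, hx, hxy⟩ := hsurj y y.2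
  refine ⟨Submodule.Quotient.mk ⟨x, hx⟩, ?_⟩
  rw [Submodule.mapQ_apply, eq_comm, Submodule.mkQ_apply, Submodule.Quotient.eq]
  exact hxy

lemma relLength_add {N M L : Submodule R A} (hNM : N ≤ M) (hML : M ≤ L) :
    relLength N L = relLength N M + relLength M L := by
  have h1 : N.submoduleOf M ≤ (N.submoduleOf L).comap (Submodule.inclusion hML) :=
    fun x hx => hx
  have h2 : N.submoduleOf L ≤ (M.submoduleOf L).comap LinearMap.id := fun x hx => hNM hx
  refine Module.length_eq_add_of_exact (Submodule.mapQ _ _ (Submodule.inclusion hML) h1)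
    (Submodule.mapQ _ _ LinearMap.id h2) ?_ ?_ ?_
  · rw [← LinearMap.ker_eq_bot, Submodule.ker_mapQ, ← le_bot_iff,
    Submodule.map_le_iff_le_comap]
    exact fun x hx => (Submodule.Quotient.mk_eq_zero _).mpr hx
  · intro y
    obtain ⟨y, rfl⟩ := Submodule.mkQ_surjective _ y
    exact ⟨Submodule.Quotient.mk y, rfl⟩
  · intro y
    obtain ⟨y, rfl⟩ := Submodule.mkQ_surjective _ y
    rw [Submodule.mkQ_apply, Submodule.mapQ_apply, Submodule.Quotient.mk_eq_zero]
    constructor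
    · intro hy
      exact ⟨Submodule.Quotient.mk ⟨y, hy⟩, rfl⟩
    · rintro ⟨x, hx⟩
      obtain ⟨x, rfl⟩ := Submodule.mkQ_surjective _ x
      rw [Submodule.mkQ_apply, Submodule.mapQ_apply, Submodule.Quotient.eq] at hx
      have h3 := M.sub_mem x.2 (hNM hx)
      change (y : A) ∈ M
      simpa using h3

end RelLength

/-! ### Filtrations by a valuation -/

namespace LatticeValuation

variable {F : Type*} [Field F] {d : ℕ} {a : Fin d → ℝ} (ν : LatticeValuation F a)
variable {D : Type*} [CommRing D] [Algebra D F]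

lemma val_pow (x : Fˣ) (n : ℕ) : ν.val (x ^ n) = n • ν.val x := by
  induction n with
  | zero => simpa using ν.val_one
  | succ n ih => rw [pow_succ, ν.val_mul, ih, succ_nsmul]

lemma mem_ring_iff {x : F} : x ∈ ν.ring ↔ ∀ y : Fˣ, (y : F) = x → 0 ≤ weight a (ν.val y) := by
  rw [← weight_zero a]
  rfl

/-- The values of the nonzero elements of `D` form a semigroup. -/
def valueSemigroup (D : Type*) [CommRing D] [Algebra D F] : AddSubmonoid (Fin d → ℤ) where
  carrier := ν.semigroup D
  zero_mem' := ⟨1, ⟨1, by simp⟩, ν.val_one⟩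
  add_mem' := by
    rintro _ _ ⟨x, ⟨b, hb⟩, rfl⟩ ⟨y, ⟨c, hc⟩, rfl⟩
    exact ⟨x * y, ⟨b * c, by simp [hb, hc]⟩, ν.val_mul x y⟩

lemma valueSemigroup_generates [IsDomain D] [IsFractionRing D F] (z : Fin d → ℤ) :
    ∃ s ∈ ν.valueSemigroup D, ∃ s' ∈ ν.valueSemigroup D, s - s' = z := by
  obtain ⟨x, rfl⟩ := ν.surjective z
  obtain ⟨b, c, hc, h⟩ := IsFractionRing.div_surjective (A := D) (x : F)
  have hc0 : algebraMap D F c ≠ 0 := by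
    simpa using nonZeroDivisors.ne_zero hc
  have hb0 : algebraMap D F b ≠ 0 := by
    intro hb
    rw [hb, zero_div] at h
    exact x.ne_zero h.symm
  refine ⟨ν.val (Units.mk0 _ hb0), ⟨_, ⟨b, rfl⟩, rfl⟩, ν.val (Units.mk0 _ hc0),
    ⟨_, ⟨c, rfl⟩, rfl⟩, ?_⟩
  have hx : x = Units.mk0 _ hb0 * (Units.mk0 _ hc0)⁻¹ := by
    ext
    simp [← h, div_eq_mul_inv]
  rw [hx, ν.val_mul, ν.val_inv, sub_eq_add_neg]

/-- The `D`-submodule of all `x` in `F` with `x = 0` or value of weight at least `t`. -/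
def geSub (hD : ∀ x : D, algebraMap D F x ∈ ν.ring) (t : ℝ) : Submodule D F where
  carrier := {x | ∀ y : Fˣ, (y : F) = x → t ≤ weight a (ν.val y)}
  zero_mem' := fun y hy => absurd hy y.ne_zero
  add_mem' := by
    intro x y hx hy z hz
    by_cases hx0 : x = 0
    · exact hy z (by simpa [hx0] using hz)
    by_cases hy0 : y = 0
    · exact hx z (by simpa [hy0] using hz)
    exact (le_min (hx (Units.mk0 x hx0) rfl) (hy (Units.mk0 y hy0) rfl)).trans
      (ν.val_add _ _ z (by simpa using hz))
  smul_mem' := by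
    intro b x hx z hz
    rw [Algebra.smul_def] at hz
    have hb0 : algebraMap D F b ≠ 0 := by intro h; exact z.ne_zero (by rw [hz, h, zero_mul])
    have hx0 : x ≠ 0 := by rintro rfl; exact z.ne_zero (by rw [hz, mul_zero])
    have hbx : z = Units.mk0 _ hb0 * Units.mk0 x hx0 := by ext; simpa using hz
    rw [hbx, ν.val_mul, weight_add]
    have h1 := ν.mem_ring_iff.mp (hD b) (Units.mk0 _ hb0) rfl
    have h2 := hx (Units.mk0 x hx0) rfl
    linarith

/-- The `D`-submodule of all `x` in `F` with `x = 0` or value of weight greater than `t`. -/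
def gtSub (hD : ∀ x : D, algebraMap D F x ∈ ν.ring) (t : ℝ) : Submodule D F where
  carrier := {x | ∀ y : Fˣ, (y : F) = x → t < weight a (ν.val y)}
  zero_mem' := fun y hy => absurd hy y.ne_zero
  add_mem' := by
    intro x y hx hy z hz
    by_cases hx0 : x = 0
    · exact hy z (by simpa [hx0] using hz)
    by_cases hy0 : y = 0
    · exact hx z (by simpa [hy0] using hz)
    exact (lt_min (hx (Units.mk0 x hx0) rfl) (hy (Units.mk0 y hy0) rfl)).trans_le
      (ν.val_add _ _ z (by simpa using hz))
  smul_mem' := by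
    intro b x hx z hz
    rw [Algebra.smul_def] at hz
    have hb0 : algebraMap D F b ≠ 0 := by intro h; exact z.ne_zero (by rw [hz, h, zero_mul])
    have hx0 : x ≠ 0 := by rintro rfl; exact z.ne_zero (by rw [hz, mul_zero])
    have hbx : z = Units.mk0 _ hb0 * Units.mk0 x hx0 := by ext; simpa using hz
    rw [hbx, ν.val_mul, weight_add]
    have h1 := ν.mem_ring_iff.mp (hD b) (Units.mk0 _ hb0) rfl
    have h2 := hx (Units.mk0 x hx0) rfl
    linarith

variable {ν} {hD : ∀ x : D, algebraMap D F x ∈ ν.ring}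

lemma units_mem_geSub {t : ℝ} {x : Fˣ} : (x : F) ∈ ν.geSub hD t ↔ t ≤ weight a (ν.val x) :=
  ⟨fun h => h x rfl, fun h y hy => by rwa [Units.ext hy]⟩

lemma units_mem_gtSub {t : ℝ} {x : Fˣ} : (x : F) ∈ ν.gtSub hD t ↔ t < weight a (ν.val x) :=
  ⟨fun h => h x rfl, fun h y hy => by rwa [Units.ext hy]⟩

lemma inv_mul_mem_geSub (g : Fˣ) {t : ℝ} {x : F} :
    (g⁻¹ : Fˣ) * x ∈ ν.geSub hD t ↔ x ∈ ν.geSub hD (weight a (ν.val g) + t) := by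
  by_cases hx : x = 0
  · simp [hx]
  obtain ⟨x, rfl⟩ : ∃ y : Fˣ, (y : F) = x := ⟨Units.mk0 x hx, rfl⟩
  have h := weight_add a (ν.val g) (ν.val (g⁻¹ * x))
  rw [← ν.val_mul, mul_inv_cancel_left] at h
  rw [← Units.val_mul, units_mem_geSub, units_mem_geSub, h]
  constructor <;> intro h <;> linarith

lemma inv_mul_mem_gtSub (g : Fˣ) {t : ℝ} {x : F} :
    (g⁻¹ : Fˣ) * x ∈ ν.gtSub hD t ↔ x ∈ ν.gtSub hD (weight a (ν.val g) + t) := by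
  by_cases hx : x = 0
  · simp [hx]
  obtain ⟨x, rfl⟩ : ∃ y : Fˣ, (y : F) = x := ⟨Units.mk0 x hx, rfl⟩
  have h := weight_add a (ν.val g) (ν.val (g⁻¹ * x))
  rw [← ν.val_mul, mul_inv_cancel_left] at h
  rw [← Units.val_mul, units_mem_gtSub, units_mem_gtSub, h]
  constructor <;> intro h <;> linarith

variable (ν hD)

/-- The ideal of all elements of `D` that are zero or have value of weight at least `t`. -/
def geIdeal (t : ℝ) : Ideal D := (ν.geSub hD t).comap (Algebra.linearMap D F)

/-- The ideal of all elements of `D` that are zero or have value of weight greater than `t`. -/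
def gtIdeal (t : ℝ) : Ideal D := (ν.gtSub hD t).comap (Algebra.linearMap D F)

/-- The length of the graded piece of the ideal `I` at the value `u`. -/
noncomputable def gradedLength (I : Ideal D) (u : Fin d → ℤ) : ℕ∞ :=
  relLength (I ⊓ ν.gtIdeal hD (weight a u)) (I ⊓ ν.geIdeal hD (weight a u))

variable {ν hD}

/-- By injectivity of the weight, an element of the same weight as `u` has value `u`. -/
lemma gradedLength_eq_zero {I : Ideal D} (ha : Function.Injective (weight a)) {u : Fin d → ℤ}
    (hu : u ∉ ν.idealImage I) : ν.gradedLength hD I u = 0 := by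
  refine relLength_eq_zero fun x hx => ⟨hx.1, fun y hy => ?_⟩
  refine lt_of_le_of_ne (hx.2 y hy) fun h => hu ?_
  exact ⟨y, ⟨x, hx.1, hy.symm⟩, (ha h).symm⟩

/-- Division by an element of value `u` embeds the graded piece into the one of `F` at weight zero,
the residue field of the valuation ring. -/
lemma gradedLength_le (I : Ideal D) (u : Fin d → ℤ) :
    ν.gradedLength hD I u ≤ relLength (ν.gtSub hD 0) (ν.geSub hD 0) := by
  obtain ⟨g, rfl⟩ := ν.surjective u
  refine relLength_le_of_map (LinearMap.mulLeft D ((g⁻¹ : Fˣ) : F) ∘ₗ Algebra.linearMap D F)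
    (fun x hx => ?_) (fun x hx => ?_)
  · refine (inv_mul_mem_geSub (hD := hD) g).mpr ?_
    rw [add_zero]
    exact hx.2
  · refine Iff.trans ?_ (inv_mul_mem_gtSub (hD := hD) g).symm
    rw [add_zero]
    exact ⟨fun h => h.2, fun h => ⟨hx.1, h⟩⟩

/-- If the elements of the valuation ring are, up to elements of positive value, fractions with
denominator `c`, the graded pieces of an ideal at the values `ν x + ν c` are as large as possible. -/
lemma gradedLength_eq {I : Ideal D} {c : Fˣ}
    (hc : ∀ y ∈ ν.geSub hD 0, ∃ b : D, y - (c⁻¹ : Fˣ) * algebraMap D F b ∈ ν.gtSub hD 0)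
    {u : Fin d → ℤ} (hu : u - ν.val c ∈ ν.idealImage I) :
    ν.gradedLength hD I u = relLength (ν.gtSub hD 0) (ν.geSub hD 0) := by
  obtain ⟨g, ⟨x, hxI, hxg⟩, hg⟩ := hu
  have hgu : ν.val (g * c) = u := by rw [ν.val_mul, hg, sub_add_cancel]
  subst hgu
  refine relLength_eq_of_map
    (LinearMap.mulLeft D (((g * c)⁻¹ : Fˣ) : F) ∘ₗ Algebra.linearMap D F)
    (fun x hx => ?_) (fun x hx => ?_) fun y hy => ?_
  · refine (inv_mul_mem_geSub (hD := hD) (g * c)).mpr ?_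
    rw [add_zero]
    exact hx.2
  · refine Iff.trans ?_ (inv_mul_mem_gtSub (hD := hD) (g * c)).symm
    rw [add_zero]
    exact ⟨fun h => h.2, fun h => ⟨hx.1, h⟩⟩
  -- As `x` has value `u - ν c`, the element `x * b` of `I` lifts the class of `y`: divided by `g *
  -- c`, it becomes the fraction `b / c`.
  · obtain ⟨b, hb⟩ := hc y hy
    have hφ : (((g * c)⁻¹ : Fˣ) : F) * algebraMap D F (x * b) = (c⁻¹ : Fˣ) * algebraMap D F b := by
      rw [map_mul, hxg]
      simp only [mul_inv, Units.val_mul, Units.val_inv_eq_inv_val]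
      field_simp
    refine ⟨x * b, ⟨I.mul_mem_right _ hxI, ?_⟩, ?_⟩
    · have h : (((g * c)⁻¹ : Fˣ) : F) * algebraMap D F (x * b) ∈ ν.geSub hD 0 := by
        rw [hφ]
        have hlt : ν.gtSub hD 0 ≤ ν.geSub hD 0 := fun z hz w hw => (hz w hw).le
        have := (ν.geSub hD 0).sub_mem hy (hlt hb)
        rwa [sub_sub_cancel] at this
      rw [inv_mul_mem_geSub, add_zero] at h
      exact h
    · change y - (((g * c)⁻¹ : Fˣ) : F) * algebraMap D F (x * b) ∈ _
      rwa [hφ]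

/-- Peel off the point of `s` of largest weight: no value of `D` lies strictly between it and `t`,
so weight at least `t` means weight greater than that of this point. -/
lemma relLength_geIdeal (ha : Function.Injective (weight a)) {S : Set (Fin d → ℤ)}
    (hS : ν.semigroup D ⊆ S) (I : Ideal D) {t : ℝ} {s : Finset (Fin d → ℤ)}
    (hs : ∀ u, u ∈ s ↔ u ∈ S ∧ weight a u < t) :
    relLength (I ⊓ ν.geIdeal hD t) I = ∑ u ∈ s, ν.gradedLength hD I u := by
  classical
  induction h : s.card generalizing s t with
  | zero =>
    rw [Finset.card_eq_zero] at h
    subst h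
    rw [Finset.sum_empty]
    refine relLength_eq_zero fun x hx => ⟨hx, fun y hy => ?_⟩
    by_contra! hlt
    exact Finset.notMem_empty _ ((hs (ν.val y)).mpr ⟨hS ⟨y, ⟨x, hy.symm⟩, rfl⟩, hlt⟩)
  | succ n ih =>
    obtain ⟨u, hu, hmax⟩ := s.exists_max_image (weight a) (Finset.card_pos.mp (by omega))
    have hut := (hs u).mp hu
    have h1 := ih (t := weight a u) (s := s.erase u) (fun w => by
      rw [Finset.mem_erase, hs]
      constructor
      · rintro ⟨hne, hw⟩
        exact ⟨hw.1, lt_of_le_of_ne (hmax w ((hs w).mpr hw)) fun h => hne (ha h)⟩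
      · rintro ⟨hw, hlt⟩
        exact ⟨fun h => hlt.ne (congrArg _ h), hw, hlt.trans hut.2⟩)
      (by rw [Finset.card_erase_of_mem hu, h, Nat.add_sub_cancel])
    have h2 : I ⊓ ν.geIdeal hD t = I ⊓ ν.gtIdeal hD (weight a u) := by
      ext x
      refine ⟨fun hx => ⟨hx.1, fun y hy => hut.2.trans_le (hx.2 y hy)⟩,
        fun hx => ⟨hx.1, fun y hy => ?_⟩⟩
      by_contra! hlt
      exact (hx.2 y hy).not_ge
        (hmax _ ((hs (ν.val y)).mpr ⟨hS ⟨y, ⟨x, hy.symm⟩, rfl⟩, hlt⟩))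
    rw [h2, relLength_add (M := I ⊓ ν.geIdeal hD (weight a u))
      (inf_le_inf_left _ fun x hx y hy => (hx y hy).le) inf_le_left, h1,
      ← Finset.add_sum_erase s _ hu]
    rfl

end LatticeValuation

end PBody

/-! ### The residue field of the valuation ring -/

namespace PBody
namespace LatticeValuation

variable {F : Type*} [Field F] {d : ℕ} {a : Fin d → ℝ} {ν : LatticeValuation F a}
variable {D : Type*} [CommRing D] [Algebra D F]

lemma mem_geSub_zero (hD : ∀ x : D, algebraMap D F x ∈ ν.ring) {x : F} :
    x ∈ ν.geSub hD 0 ↔ x ∈ ν.ring := ν.mem_ring_iff.symm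

lemma residue_eq_zero_iff_mem_gtSub (hD : ∀ x : D, algebraMap D F x ∈ ν.ring) (x : ν.ring) :
    IsLocalRing.residue ν.ring x = 0 ↔ (x : F) ∈ ν.gtSub hD 0 := by
  rw [IsLocalRing.residue_eq_zero_iff, IsLocalRing.mem_maximalIdeal, mem_nonunits_iff]
  constructor
  · intro h y hy
    refine lt_of_le_of_ne (ν.mem_ring_iff.mp x.2 y hy) fun h0 => h ?_
    have hinv : ((y⁻¹ : Fˣ) : F) ∈ ν.ring := by
      refine ν.mem_ring_iff.mpr fun z hz => ?_
      have hzy := weight_add a (ν.val z) (ν.val y)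
      rw [← ν.val_mul, Units.ext hz, inv_mul_cancel, ν.val_one, weight_zero] at hzy
      rw [Units.ext hz]
      linarith
    exact IsUnit.of_mul_eq_one ⟨_, hinv⟩ (Subtype.ext (by simp [← hy]))
  · rintro h ⟨w, rfl⟩
    have hw : ((w : ν.ring) : F) * ((w⁻¹ : ν.ringˣ) : ν.ring) = 1 := by
      rw [← MulMemClass.coe_mul, Units.mul_inv, OneMemClass.coe_one]
    set y := Units.mk0 ((w : ν.ring) : F) (left_ne_zero_of_mul_eq_one hw)
    set z := Units.mk0 (((w⁻¹ : ν.ringˣ) : ν.ring) : F) (right_ne_zero_of_mul_eq_one hw)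
    have h1 : 0 < weight a (ν.val y) := h y rfl
    have h2 : 0 ≤ weight a (ν.val z) := ν.mem_ring_iff.mp (w⁻¹ : ν.ringˣ).val.2 z rfl
    have hyz : y * z = 1 := Units.ext hw
    have h3 := weight_add a (ν.val y) (ν.val z)
    rw [← ν.val_mul, hyz, ν.val_one, weight_zero] at h3
    linarith

/-- The length over `D` of the residue field of the valuation ring. -/
lemma relLength_gtSub_geSub [IsLocalRing D] (h : ν.Dominates D) (hfin : (ν.residueMap h).Finite) :
    relLength (ν.gtSub h.mem_ring 0) (ν.geSub h.mem_ring 0) = ν.residueDegree h := by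
  let := (ν.residueMap h).toAlgebra
  let : Module D (IsLocalRing.ResidueField ν.ring) :=
    Module.compHom _ (IsLocalRing.residue D)
  have : IsScalarTower D (IsLocalRing.ResidueField D) (IsLocalRing.ResidueField ν.ring) :=
    ⟨fun x y z => by
      rw [Algebra.smul_def x y, mul_smul]
      rfl⟩
  have : Module.Finite (IsLocalRing.ResidueField D) (IsLocalRing.ResidueField ν.ring) := hfin
  let ψ : ν.geSub h.mem_ring 0 →ₗ[D] IsLocalRing.ResidueField ν.ring :=
    { toFun := fun x => IsLocalRing.residue ν.ring ⟨x, (mem_geSub_zero _).mp x.2⟩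
      map_add' := fun x y => by rw [← map_add]; rfl
      map_smul' := fun b x => by
        have : (⟨((b • x : ν.geSub h.mem_ring 0) : F), (mem_geSub_zero _).mp (b • x).2⟩ : ν.ring) =
            ⟨algebraMap D F b, h.mem_ring b⟩ * ⟨x, (mem_geSub_zero _).mp x.2⟩ :=
          Subtype.ext (Algebra.smul_def b (x : F))
        rw [this, map_mul]
        rfl }
  have hψ : Function.Surjective ψ := fun y => by
    obtain ⟨x, rfl⟩ := IsLocalRing.residue_surjective y
    exact ⟨⟨x, (mem_geSub_zero _).mpr x.2⟩, rfl⟩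
  have hker : LinearMap.ker ψ = (ν.gtSub h.mem_ring 0).submoduleOf (ν.geSub h.mem_ring 0) := by
    ext x
    exact residue_eq_zero_iff_mem_gtSub h.mem_ring _
  -- `D` acts through its residue field, onto which it surjects, so the length over `D` is a
  -- dimension over that field.
  rw [relLength, ← hker, (ψ.quotKerEquivOfSurjective hψ).length_eq,
    Module.length_eq_of_surjective (R := IsLocalRing.ResidueField D)
      IsLocalRing.residue_surjective, Module.length_eq_finrank]
  rfl

/-- If the residue field of the valuation ring has finite length over `D`, all its elements are
residues of fractions with a common denominator. -/
lemma exists_common_denominator [IsDomain D] [IsFractionRing D F]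
    (hD : ∀ x : D, algebraMap D F x ∈ ν.ring)
    (hfin : relLength (ν.gtSub hD 0) (ν.geSub hD 0) ≠ ⊤) :
    ∃ c : Fˣ, ∀ y ∈ ν.geSub hD 0, ∃ b : D,
      y - (c⁻¹ : Fˣ) * algebraMap D F b ∈ ν.gtSub hD 0 := by
  have hfl := Module.length_ne_top_iff.mp hfin
  have : IsNoetherian D (ν.geSub hD 0 ⧸ (ν.gtSub hD 0).submoduleOf (ν.geSub hD 0)) :=
    (isFiniteLength_iff_isNoetherian_isArtinian.mp hfl).1
  obtain ⟨s, hs⟩ := IsNoetherian.noetherian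
    (⊤ : Submodule D (ν.geSub hD 0 ⧸ (ν.gtSub hD 0).submoduleOf (ν.geSub hD 0)))
  classical
  obtain ⟨c, hc⟩ := IsLocalization.exist_integer_multiples_of_finset (nonZeroDivisors D)
    (s.image fun x => 
      (((Submodule.mkQ_surjective _ x).choose : ν.geSub hD 0) : F))
  have hc0 : algebraMap D F c ≠ 0 := by
    simp
  -- The fractions with denominator `c` form a submodule containing lifts of all generators, so it
  -- surjects onto the quotient.
  let W : Submodule D F := (LinearMap.range (Algebra.linearMap D F)).comap
    (LinearMap.mulLeft D (algebraMap D F c))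
  have htop : (W.submoduleOf (ν.geSub hD 0)).map
      ((ν.gtSub hD 0).submoduleOf (ν.geSub hD 0)).mkQ = ⊤ := by
    rw [eq_top_iff, ← hs, Submodule.span_le]
    intro x hx
    refine ⟨_, ?_, (Submodule.mkQ_surjective _ x).choose_spec⟩
    obtain ⟨b, hb⟩ := hc _ (Finset.mem_image_of_mem _ hx)
    exact ⟨b, hb.trans (Algebra.smul_def _ _)⟩
  refine ⟨Units.mk0 _ hc0, fun y hy => ?_⟩
  obtain ⟨x, ⟨b, hb⟩, hxy⟩ := (htop ▸ Submodule.mem_top :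
    Submodule.mkQ _ (⟨y, hy⟩ : ν.geSub hD 0) ∈ (W.submoduleOf (ν.geSub hD 0)).map
      ((ν.gtSub hD 0).submoduleOf (ν.geSub hD 0)).mkQ)
  refine ⟨b, ?_⟩
  have hb' : algebraMap D F b = algebraMap D F c * (x : F) := hb
  have hx : ((Units.mk0 _ hc0)⁻¹ : Fˣ) * algebraMap D F b = (x : F) := by
    rw [hb', Units.val_inv_eq_inv_val, Units.val_mk0, inv_mul_cancel_left₀ hc0]
  rw [hx]
  rw [eq_comm, Submodule.mkQ_apply, Submodule.mkQ_apply, Submodule.Quotient.eq] at hxy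
  exact hxy

/-! ### `p`-families of ideals and their `p`-bodies -/

variable {p : ℕ}

lemma pow_mem_of_isPFamily {I : ℕ → Ideal D} (hI : IsPFamily p I) {e : ℕ} {x : D}
    (hx : x ∈ I e) : x ^ p ∈ I (e + 1) :=
  hI e (Ideal.subset_span ⟨x, hx, rfl⟩)

lemma idealImage_mono {I J : Ideal D} (h : I ≤ J) : ν.idealImage I ⊆ ν.idealImage J := by
  rintro _ ⟨x, ⟨b, hb, hbx⟩, rfl⟩
  exact ⟨x, ⟨b, h hb, hbx⟩, rfl⟩

lemma isPSystem_idealImage {I : ℕ → Ideal D} (hI : IsPFamily p I) :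
    IsPSystem p (ν.valueSemigroup D) fun e => ν.idealImage (I e) where
  subset := by
    rintro e _ ⟨x, ⟨b, -, hb⟩, rfl⟩
    exact ⟨x, ⟨b, hb⟩, rfl⟩
  add_mem := by
    rintro e _ ⟨x, ⟨b, hbI, hb⟩, rfl⟩ _ ⟨y, ⟨c, hc⟩, rfl⟩
    exact ⟨x * y, ⟨b * c, (I e).mul_mem_right _ hbI, by simp [hb, hc]⟩, ν.val_mul x y⟩
  nsmul_mem := by
    rintro e _ ⟨x, ⟨b, hbI, hb⟩, rfl⟩
    exact ⟨x ^ p, ⟨b ^ p, pow_mem_of_isPFamily hI hbI, by simp [hb]⟩, ν.val_pow x p⟩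

lemma natCast_ncard_le_sum {α : Type*} {s : Finset α} {G : Set α} (hG : G ⊆ s) {f : α → ℕ∞} {r : ℕ∞}
    (hf : ∀ u ∈ G, f u = r) : (G.ncard : ℕ∞) * r ≤ ∑ u ∈ s, f u := by
  classical
  have hfin : G.Finite := s.finite_toSet.subset hG
  rw [Set.ncard_eq_toFinset_card _ hfin, ← nsmul_eq_mul, ← Finset.sum_const]
  refine (Finset.sum_congr rfl fun u hu => (hf u (by simpa using hu)).symm).le.trans ?_
  exact Finset.sum_le_sum_of_subset fun u hu => hG (by simpa using hu)

lemma sum_le_natCast_ncard {α : Type*} {s : Finset α} {G : Set α} (hG : G ⊆ s) {f : α → ℕ∞} {r : ℕ∞}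
    (hf : ∀ u, f u ≤ r) (hf0 : ∀ u ∈ s, u ∉ G → f u = 0) : ∑ u ∈ s, f u ≤ (G.ncard : ℕ∞) * r := by
  classical
  have hfin : G.Finite := s.finite_toSet.subset hG
  rw [Set.ncard_eq_toFinset_card _ hfin, ← nsmul_eq_mul, ← Finset.sum_const,
    ← Finset.sum_subset (s₁ := hfin.toFinset) (fun u hu => hG (by simpa using hu))
      (fun u hu hu' => hf0 u hu (by simpa using hu'))]
  exact Finset.sum_le_sum fun u _ => hf u

/-- The shift `v` is the value of the common denominator. Its independence of `I` and `t` is what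
makes it negligible after division by `q`. -/
lemma IsOK.relLength_geIdeal_bounds [IsDomain D] [IsLocalRing D]
    [IsFractionRing D F] (ha : Function.Injective (weight a)) (hν : ν.IsOK D) :
    ∃ v : Fin d → ℤ, ∀ (I : Ideal D) (t : ℝ),
      ({u | u ∈ ν.idealImage I ∧ u - v ∈ ν.idealImage I ∧ weight a u < t}.ncard : ℕ∞) *
          ν.residueDegree hν.dominates ≤
        relLength (I ⊓ ν.geIdeal hν.dominates.mem_ring t) I ∧
      relLength (I ⊓ ν.geIdeal hν.dominates.mem_ring t) I ≤
        ({u | u ∈ ν.idealImage I ∧ weight a u < t}.ncard : ℕ∞) *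
          ν.residueDegree hν.dominates := by
  have hr := relLength_gtSub_geSub hν.dominates hν.residue_finite
  obtain ⟨c, hc⟩ := exists_common_denominator hν.dominates.mem_ring
    (by rw [hr]; exact ENat.natCast_ne_top _)
  refine ⟨ν.val c, fun I t => ?_⟩
  have hfin := finite_setOf_weight_lt (S := ν.valueSemigroup D) hν.pos_of_mem_cone t
  have hsub : ν.idealImage I ⊆ ν.valueSemigroup D := by
    rintro _ ⟨x, ⟨b, -, hb⟩, rfl⟩
    exact ⟨x, ⟨b, hb⟩, rfl⟩
  rw [relLength_geIdeal ha (S := ν.valueSemigroup D) subset_rfl I (t := t)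
    (s := hfin.toFinset) fun u => by simp]
  constructor
  · refine natCast_ncard_le_sum (fun u hu => ?_) fun u hu => (gradedLength_eq hc hu.2.1).trans hr
    simpa using ⟨hsub hu.1, hu.2.2⟩
  · refine sum_le_natCast_ncard (fun u hu => ?_) (fun u => (gradedLength_le I u).trans hr.le)
      fun u hu hu' => gradedLength_eq_zero ha fun h => hu' ⟨h, ?_⟩
    · simpa using ⟨hsub hu.1, hu.2⟩
    · simp only [Set.Finite.mem_toFinset, Set.mem_ofPred_eq] at hu
      exact hu.2

lemma tendsto_toENNReal_div {n : ℕ → ℕ} {x : ℝ≥0∞} (hx : x ≠ ⊤) (hp : 1 < p) (r : ℕ)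
    (h : Filter.Tendsto (fun e => (n e : ℝ) / ((p : ℝ) ^ e) ^ d) Filter.atTop (𝓝 x.toReal)) :
    Filter.Tendsto (fun e => (((n e : ℕ∞) * r : ℕ∞) : ℝ≥0∞) / ((p : ℝ≥0∞) ^ e) ^ d)
      Filter.atTop (𝓝 (r * x)) := by
  have h1 := (ENNReal.tendsto_ofReal h)
  rw [ENNReal.ofReal_toReal hx] at h1
  refine (ENNReal.Tendsto.const_mul h1 (Or.inr (ENNReal.natCast_ne_top r))).congr fun e => ?_
  have hp0 : 0 < ((p : ℝ) ^ e) ^ d := by positivity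
  rw [ENNReal.ofReal_div_of_pos hp0, ENNReal.ofReal_natCast, ENNReal.ofReal_pow (by positivity),
    ENNReal.ofReal_pow (by positivity), ENNReal.ofReal_natCast, ENat.toENNReal_mul,
    ENat.toENNReal_coe, ENat.toENNReal_coe, mul_comm (n e : ℝ≥0∞), mul_div_assoc]

/-- The asymptotic length of the ideals of a `p`-family modulo the elements of large value. -/
lemma IsOK.tendsto_relLength_geIdeal [IsDomain D] [IsLocalRing D]
    [IsFractionRing D F] (ha : Function.Injective (weight a)) (hν : ν.IsOK D) (hp : 1 < p) {I : ℕ → Ideal D}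
    (hI : IsPFamily p I) (α : ℝ) :
    Filter.Tendsto (fun e =>
      ((relLength (I e ⊓ ν.geIdeal hν.dominates.mem_ring ((p : ℝ) ^ e * α)) (I e) : ℕ∞) : ℝ≥0∞) /
        ((p : ℝ≥0∞) ^ e) ^ d) Filter.atTop
      (𝓝 ((ν.residueDegree hν.dominates : ℝ≥0∞) *
        MeasureTheory.volume (ν.familyBody p I ∩ {y | a ⬝ᵥ y < α}))) := by
  obtain ⟨v, hv⟩ := hν.relLength_geIdeal_bounds ha
  have hT := isPSystem_idealImage (ν := ν) hI
  have hS := ν.valueSemigroup_generates (D := D)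
  have hpos : ∀ u ∈ closedCone (ν.valueSemigroup D : Set (Fin d → ℤ)), u ≠ 0 → 0 < a ⬝ᵥ u :=
    hν.pos_of_mem_cone
  have hfin : MeasureTheory.volume (ν.familyBody p I ∩ {y | a ⬝ᵥ y < α}) ≠ ⊤ :=
    (hT.isBounded_inter hpos α).measure_lt_top.ne
  -- The zero shift gives the count in the upper bound.
  have h0 := hT.tendsto_ncard hp hS hpos α 0
  simp only [sub_zero, and_self_left] at h0
  refine tendsto_of_tendsto_of_tendsto_of_le_of_le
    (tendsto_toENNReal_div hfin hp _ (hT.tendsto_ncard hp hS hpos α v))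
    (tendsto_toENNReal_div hfin hp _ h0) (fun e => ?_) fun e => ?_
  · exact ENNReal.div_le_div_right (ENat.toENNReal_le.mpr (hv (I e) _).1) _
  · exact ENNReal.div_le_div_right (ENat.toENNReal_le.mpr (hv (I e) _).2) _

end LatticeValuation
end PBody

/-! ### Relative lengths of nested `p`-families -/

namespace PBody
namespace LatticeValuation

variable {F : Type*} [Field F] {d : ℕ} {a : Fin d → ℝ} {ν : LatticeValuation F a}
variable {D : Type*} [CommRing D] [Algebra D F] {p : ℕ}

lemma weight_nsmul (a : Fin d → ℝ) (n : ℕ) (u : Fin d → ℤ) :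
    weight a (n • u) = n * weight a u := by
  rw [weight_eq, weight_eq, toReal_nsmul, dotProduct_smul, smul_eq_mul]

/-- Otherwise the case `n = 1` would put the element 1 into the maximal ideal. -/
lemma weight_pos_of_forall_mem_pow [IsLocalRing D] {v : Fin d → ℤ}
    (hv : ∀ (n : ℕ) (x : D), algebraMap D F x ∈ ν.geSet (n • v) →
      x ∈ IsLocalRing.maximalIdeal D ^ n) : 0 < weight a v := by
  by_contra! h
  have h1 := hv 1 1 fun y hy => by
    have : y = 1 := by ext; simpa using hy
    rwa [this, ν.val_one, weight_zero, one_smul]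
  rw [pow_one] at h1
  exact (Ideal.ne_top_iff_one _).mp (IsLocalRing.maximalIdeal.isMaximal D).ne_top h1

/-- The relative multiplicity of nested `p`-families of ideals that agree in a linear power of the
maximal ideal, and the agreement of their `p`-bodies outside of a truncation of the cone. -/
lemma IsOK.tendsto_relLength [IsDomain D] [IsLocalRing D] [IsFractionRing D F]
    (ha : Function.Injective (weight a)) (hν : ν.IsOK D) (hp : 1 < p)
    {I J : ℕ → Ideal D} (hI : IsPFamily p I) (hJ : IsPFamily p J) (hIJ : ∀ e, I e ≤ J e)
    {c : ℕ} (hc : ∀ e : ℕ,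
        IsLocalRing.maximalIdeal D ^ (c * p ^ e) ⊓ I e =
          IsLocalRing.maximalIdeal D ^ (c * p ^ e) ⊓ J e) :
    Filter.Tendsto
        (fun e : ℕ => ((relLength (I e) (J e) : ℕ∞) : ℝ≥0∞) / ((p : ℝ≥0∞) ^ e) ^ d)
        Filter.atTop
        (𝓝 ((ν.residueDegree hν.dominates : ℝ≥0∞) *
          MeasureTheory.volume (ν.familyBody p J \ ν.familyBody p I))) ∧
      (ν.residueDegree hν.dominates : ℝ≥0∞) *
          MeasureTheory.volume (ν.familyBody p J \ ν.familyBody p I) < ⊤ ∧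
      ∃ T : Set (Fin d → ℝ), IsTruncation (closedCone (ν.semigroup D)) T ∧
        interior (ν.familyBody p I) \ T = interior (ν.familyBody p J) \ T ∧
        closure (ν.familyBody p I) \ T = closure (ν.familyBody p J) \ T ∧
        MeasureTheory.volume (symmDiff (ν.familyBody p I) (ν.familyBody p J) \ T) = 0 ∧
        (IsClosed (conicalHull (ν.semigroup D)) →
          ν.familyBody p I \ T = ν.familyBody p J \ T) := by
  obtain ⟨v, hv⟩ := hν.exists_vector
  have hv0 := weight_pos_of_forall_mem_pow hv
  have hD := hν.dominates.mem_ring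
  -- Weight at least `q * α` means value at least `(c * q) • v`, which forces membership in `𝔪 ^ (c
  -- * q)`.
  obtain ⟨α, hα⟩ : ∃ α : ℝ, α = c * weight a v := ⟨_, rfl⟩
  have hα0 : 0 ≤ α := by rw [hα]; positivity
  have hp0 : ∀ e : ℕ, 0 < (p : ℝ) ^ e := fun e => by positivity
  have hmem : ∀ e, ∀ x ∈ J e, algebraMap D F x ∈ ν.geSub hD ((p : ℝ) ^ e * α) → x ∈ I e := by
    intro e x hx hxα
    have hm : x ∈ IsLocalRing.maximalIdeal D ^ (c * p ^ e) := by
      refine hv _ _ fun y hy => ?_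
      rw [weight_nsmul]
      refine le_of_eq_of_le ?_ (hxα y hy)
      rw [hα]
      push_cast
      ring
    have h : x ∈ IsLocalRing.maximalIdeal D ^ (c * p ^ e) ⊓ J e := ⟨hm, hx⟩
    rw [← hc e] at h
    exact h.2
  have hTI := isPSystem_idealImage (ν := ν) hI
  have hTJ := isPSystem_idealImage (ν := ν) hJ
  have hS := ν.valueSemigroup_generates (D := D)
  have hpos : ∀ u ∈ closedCone (ν.valueSemigroup D : Set (Fin d → ℤ)), u ≠ 0 → 0 < a ⬝ᵥ u :=
    hν.pos_of_mem_cone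
  have hsub : ∀ e, ν.idealImage (I e) ⊆ ν.idealImage (J e) := fun e => idealImage_mono (hIJ e)
  have hagree : ∀ e, ∀ u ∈ ν.idealImage (J e), (p : ℝ) ^ e * α ≤ weight a u →
      u ∈ ν.idealImage (I e) := by
    rintro e _ ⟨x, ⟨b, hb, hbx⟩, rfl⟩ hle
    refine ⟨x, ⟨b, hmem e b hb ?_, hbx⟩, rfl⟩
    rw [hbx]
    exact units_mem_geSub.mpr hle
  have hIfin : MeasureTheory.volume (ν.familyBody p I ∩ {y | a ⬝ᵥ y < α + 1}) ≠ ⊤ :=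
    (hTI.isBounded_inter hpos (α + 1)).measure_lt_top.ne
  have hJfin : MeasureTheory.volume (ν.familyBody p J ∩ {y | a ⬝ᵥ y < α + 1}) ≠ ⊤ :=
    (hTJ.isBounded_inter hpos (α + 1)).measure_lt_top.ne
  have hvol' := IsPSystem.volume_diff hp hS hpos hTI hTJ hsub hagree
  have hvol : MeasureTheory.volume (ν.familyBody p J \ ν.familyBody p I) =
      MeasureTheory.volume (ν.familyBody p J ∩ {y | a ⬝ᵥ y < α + 1}) -
        MeasureTheory.volume (ν.familyBody p I ∩ {y | a ⬝ᵥ y < α + 1}) :=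
    hvol'
  have hnull := hTJ.volume_diff_eq_zero hp hS hagree
  have hint := hTJ.interior_diff_eq hp hS hsub hagree
  have hclos := hTJ.closure_diff_eq hp hS hsub hagree
  have hclosed := hTJ.diff_eq_of_isClosed hp hsub hagree
  refine ⟨?_, ?_, closedCone (ν.semigroup D) ∩ {y | a ⬝ᵥ y < α + 1},
    ⟨a, α + 1, hpos, by positivity, rfl⟩, hint, hclos, ?_, hclosed⟩
  · rw [hvol, ENNReal.mul_sub fun _ _ => ENNReal.natCast_ne_top _]
    refine (ENNReal.Tendsto.sub (hν.tendsto_relLength_geIdeal ha hp hJ (α + 1))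
      (hν.tendsto_relLength_geIdeal ha hp hI (α + 1))
      (Or.inl (ENNReal.mul_ne_top (ENNReal.natCast_ne_top _) hJfin))).congr fun e => ?_
    obtain ⟨t, ht⟩ : ∃ t, t = (p : ℝ) ^ e * (α + 1) := ⟨_, rfl⟩
    rw [← ht]
    have hle : (p : ℝ) ^ e * α ≤ t := ht ▸ mul_le_mul_of_nonneg_left (by linarith) (hp0 e).le
    -- Both families have the same part of weight at least `t`, so the length of `J e / I e` is the
    -- difference of their lengths modulo it.
    have heq : J e ⊓ ν.geIdeal hD t = I e ⊓ ν.geIdeal hD t :=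
      le_antisymm (fun x hx => ⟨hmem e x hx.1 fun y hy => hle.trans (hx.2 y hy), hx.2⟩)
        (inf_le_inf_right _ (hIJ e))
    have hadd := relLength_add (inf_le_left : I e ⊓ ν.geIdeal hD t ≤ I e) (hIJ e)
    -- Finiteness is needed to cancel this term in the extended reals.
    have hne : ((relLength (I e ⊓ ν.geIdeal hD t) (I e) : ℕ∞) : ℝ≥0∞) ≠ ⊤ := by
      obtain ⟨w, hw⟩ := hν.relLength_geIdeal_bounds ha
      rw [ENat.toENNReal_ne_top]
      refine ne_top_of_le_ne_top ?_ (hw (I e) t).2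
      exact_mod_cast ENat.natCast_ne_top _
    rw [heq, hadd, ENat.toENNReal_add, ENNReal.add_div]
    refine ENNReal.add_sub_cancel_left (ENNReal.div_ne_top hne ?_)
    have : p ≠ 0 := by omega
    simp [this]
  · rw [hvol]
    exact ENNReal.mul_lt_top (ENNReal.natCast_lt_top _) (tsub_le_self.trans_lt hJfin.lt_top)
  · have hmono : ν.familyBody p I ⊆ ν.familyBody p J := pBody_mono hsub
    rw [symmDiff_of_le hmono]
    exact hnull

/-- The element 1 has value 0, so the term `q = 1` already contributes the whole cone. -/
lemma familyBody_top : ν.familyBody p (fun _ => (⊤ : Ideal D)) = closedCone (ν.semigroup D) := by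
  have htop : IsPFamily p fun _ => (⊤ : Ideal D) := fun _ => le_top
  refine Set.Subset.antisymm (isPSystem_idealImage (ν := ν) htop).pBody_subset fun y hy => ?_
  exact mem_pBody.mpr ⟨0, 0, ⟨1, ⟨1, trivial, by simp⟩, ν.val_one⟩, y, hy, by simp⟩

end LatticeValuation

/-! ### Linear powers of the maximal ideal inside a `p`-family -/

section PFamily

variable {R : Type*} [CommRing R]

/-- Pigeonhole on the exponents of the generators, added one at a time. The extra 1 covers the empty
set, where a zeroth power would be the unit ideal. -/
lemma span_pow_card_mul_le (s : Finset R) (n : ℕ) :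
    Ideal.span (s : Set R) ^ (s.card * n + 1) ≤ Ideal.span ((fun x => x ^ n) '' (s : Set R)) := by
  classical
  induction s using Finset.induction_on with
  | empty => simp
  | insert x s hx ih =>
    rw [Finset.card_insert_of_notMem hx, Finset.coe_insert, Ideal.span_insert, Set.image_insert_eq,
      Ideal.span_insert, add_mul, one_mul, add_comm _ n, add_assoc]
    refine Ideal.sup_pow_add_le_pow_sup_pow.trans (sup_le_sup ?_ ih)
    rw [Ideal.span_singleton_pow]

lemma IsPFamily.pow_mem {p : ℕ} {I : ℕ → Ideal R} (hI : IsPFamily p I) {x : R} (hx : x ∈ I 0)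
    (e : ℕ) : x ^ p ^ e ∈ I e := by
  induction e with
  | zero => simpa using hx
  | succ e ih =>
    rw [pow_succ, pow_mul]
    exact hI e (Ideal.subset_span ⟨_, ih, rfl⟩)

/-- A `p`-family of primary ideals to the maximal ideal contains a linear power of it. -/
lemma IsPFamily.exists_maximalIdeal_pow_le [IsLocalRing R] [IsNoetherianRing R] {p : ℕ} (hp : 0 < p)
    {I : ℕ → Ideal R} (hI : IsPFamily p I) (h0 : IsMPrimary (I 0)) :
    ∃ c : ℕ, 0 < c ∧ ∀ e, IsLocalRing.maximalIdeal R ^ (c * p ^ e) ≤ I e := by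
  obtain ⟨b, hb⟩ := Ideal.exists_pow_le_of_le_radical_of_fg h0.2.ge
    (IsNoetherian.noetherian (IsLocalRing.maximalIdeal R))
  obtain ⟨s, hs⟩ := IsNoetherian.noetherian (I 0)
  -- As `q ≥ 1`, this constant times `q` is at least `b * (s.card * q + 1)`; the final 1 makes it
  -- visibly positive.
  refine ⟨b * s.card + b + 1, Nat.succ_pos _, fun e => ?_⟩
  calc IsLocalRing.maximalIdeal R ^ ((b * s.card + b + 1) * p ^ e)
      ≤ IsLocalRing.maximalIdeal R ^ (b * (s.card * p ^ e + 1)) :=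
        Ideal.pow_le_pow_right (by nlinarith [Nat.pow_pos (n := e) hp])
    _ = (IsLocalRing.maximalIdeal R ^ b) ^ (s.card * p ^ e + 1) := pow_mul _ _ _
    _ ≤ I 0 ^ (s.card * p ^ e + 1) := Ideal.pow_right_mono hb _
    _ = Ideal.span (s : Set R) ^ (s.card * p ^ e + 1) := by rw [← hs]
    _ ≤ Ideal.span ((fun x => x ^ p ^ e) '' (s : Set R)) := span_pow_card_mul_le s _
    _ ≤ I e := by
        refine Ideal.span_le.mpr ?_
        rintro _ ⟨x, hx, rfl⟩
        exact hI.pow_mem (hs ▸ Ideal.subset_span hx) e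

lemma relLength_top (I : Ideal R) : relLength I ⊤ = Module.length R (R ⧸ I) := by
  refine (Submodule.Quotient.equiv (I.submoduleOf ⊤) I Submodule.topEquiv ?_).length_eq
  ext x
  constructor
  · rintro ⟨y, hy, rfl⟩
    exact hy
  · exact fun hx => ⟨⟨x, trivial⟩, hx, rfl⟩

end PFamily

end PBody

theorem mainTheorem2 {p : ℕ} [Fact p.Prime]
    {D : Type*} [CommRing D] [IsDomain D] [IsLocalRing D] [IsNoetherianRing D] [CharP D p]
    {F : Type*} [Field F] [Algebra D F] [IsFractionRing D F]
    {d : ℕ} (hd : ringKrullDim D = (d : WithBot ℕ∞))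
    (a : Fin d → ℝ) (ha : Function.Injective (PBody.weight a))
    (ν : PBody.LatticeValuation F a) (hν : ν.IsOK D) :
    (∀ I J : ℕ → Ideal D, PBody.IsPFamily p I → PBody.IsPFamily p J → (∀ e, I e ≤ J e) →
      (∃ c : ℕ, 0 < c ∧ ∀ e : ℕ,
        IsLocalRing.maximalIdeal D ^ (c * p ^ e) ⊓ I e =
          IsLocalRing.maximalIdeal D ^ (c * p ^ e) ⊓ J e) →
      Filter.Tendsto
          (fun e : ℕ => ((Module.length D (J e ⧸ (I e).submoduleOf (J e)) : ℕ∞) : ℝ≥0∞) /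
            ((p : ℝ≥0∞) ^ e) ^ d)
          Filter.atTop
          (𝓝 ((ν.residueDegree hν.dominates : ℝ≥0∞) *
            MeasureTheory.volume (ν.familyBody p J \ ν.familyBody p I))) ∧
      (ν.residueDegree hν.dominates : ℝ≥0∞) *
          MeasureTheory.volume (ν.familyBody p J \ ν.familyBody p I) < ⊤ ∧
      ∃ T : Set (Fin d → ℝ), PBody.IsTruncation (PBody.closedCone (ν.semigroup D)) T ∧
        interior (ν.familyBody p I) \ T = interior (ν.familyBody p J) \ T ∧
        closure (ν.familyBody p I) \ T = closure (ν.familyBody p J) \ T ∧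
        MeasureTheory.volume (symmDiff (ν.familyBody p I) (ν.familyBody p J) \ T) = 0 ∧
        (IsClosed (PBody.conicalHull (ν.semigroup D)) →
          ν.familyBody p I \ T = ν.familyBody p J \ T)) ∧
    (∀ I : ℕ → Ideal D, PBody.IsPFamily p I → (∀ e, PBody.IsMPrimary (I e)) →
      Filter.Tendsto
          (fun e : ℕ => ((Module.length D (D ⧸ I e) : ℕ∞) : ℝ≥0∞) / ((p : ℝ≥0∞) ^ e) ^ d)
          Filter.atTop
          (𝓝 ((ν.residueDegree hν.dominates : ℝ≥0∞) *
            MeasureTheory.volume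
              (PBody.closedCone (ν.semigroup D) \ ν.familyBody p I))) ∧
      (ν.residueDegree hν.dominates : ℝ≥0∞) *
          MeasureTheory.volume
            (PBody.closedCone (ν.semigroup D) \ ν.familyBody p I) < ⊤) := by
  have hp := (Fact.out : p.Prime).one_lt
  refine ⟨fun I J hI hJ hIJ ⟨c, _, hc⟩ => hν.tendsto_relLength ha hp hI hJ hIJ hc,
    fun I hI hprim => ?_⟩
  obtain ⟨c, -, hc⟩ := hI.exists_maximalIdeal_pow_le (by omega) (hprim 0)
  -- Compare with the constant unit family: intersecting `𝔪 ^ (c * q)` with either ideal gives `𝔪 ^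
  -- (c * q)` itself.
  obtain ⟨h1, h2, -⟩ := hν.tendsto_relLength ha hp hI
    (J := fun _ => (⊤ : Ideal D)) (fun _ => le_top) (fun _ => le_top) (c := c)
    fun e => by rw [inf_top_eq, inf_eq_left.mpr (hc e)]
  rw [PBody.LatticeValuation.familyBody_top] at h1 h2
  simp only [PBody.relLength_top] at h1
  exact ⟨h1, h2⟩
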